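/- Let $\mathbb K\in\{\mathbb R,\mathbb C\}$. Smooth maps between open subsets of locally convex Hausdorff $\mathbb K$-spaces are understood in the Michal–Bastiani sense ($f$ is $C^{1}$ if it is continuous and its directional derivatives $df(x)(h)$ exist and are jointly continuous in $(x,h)$; $f$ is $C^{n+1}$ if it is $C^1$ and $df$ is $C^n$; smooth means $C^n$ for all $n$), and a Lie group is a group which is a smooth manifold modeled on a locally convex Hausdorff space with smooth multiplication and inversion. Let $G$ and $N$ be Lie groups, $\mathrm{Aut}(N)$ the group of Lie group automorphisms of $N$, and $C_N(n)(x)=nxn^{-1}$. *Cochains.* $C^1_s(G,N)$ is the set of maps $h:G\to N$ with $h(1)=1$ that are smooth on an open identity neighborhood. $C^2_{ss}(G,N)$ is the set of maps $\omega:G\times G\to N$ that are smooth on an open identity neighborhood, satisfy $\omega(g,1)=\omega(1,g)=1$ for all $g$, and for which each map $x\mapsto \omega(g,x)\,\omega(gxg^{-1},g)^{-1}$, $g\in G$, is smooth on an identity neighborhood of $G$. $C^1_s(G,\mathrm{Aut}(N))$ is the set of maps $S:G\to\mathrm{Aut}(N)$ with $S(1)=\mathrm{id}_N$ such that $(g,n)\mapsto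 S(g)(n)$ is smooth on $U\times N$ for some open identity neighborhood $U\subseteq G$. The set $Z^2_{ss}(G,N)$ of smooth factor systems consists of the pairs $(S,\omega)\in C^1_s(G,\mathrm{Aut}(N))\times C^2_{ss}(G,N)$ with $$S(g)S(g')S(gg')^{-1}=C_N(\omega(g,g')),\qquad S(g)(\omega(g',g''))\,\omega(g,g'g'')\,\omega(gg',g'')^{-1}\,\omega(g,g')^{-1}=1 .$$ *Extensions.* A Lie group extension of $G$ by $N$ is a short exact sequence $1\to N\xrightarrow{\iota}\widehat G\xrightarrow{q}G\to1$ of Lie group morphisms that makes $\widehat G$ a smooth $N$-principal bundle over $G$ (every $g\in G$ has an open neighborhood $U$ with a smooth section $\sigma:U\to\widehat G$ of $q$ such that $(x,n)\mapsto\sigma(x)\iota(n)$ is a diffeomorphism $U\times N\to q^{-1}(U)$). An equivalence from $\widehat G_1$ to $\widehat G_2$ is a Lie group morphism $\varphi:\widehat G_1\to\widehat G_2$ with $\varphi\circ\iota_1=\iota_2$ and $q_2\circ\varphi=q_1$; the existence of one is an equivalence relation on extensions, and $\mathrm{Ext}(G,N)$ is the set of equivalence classes. For $(S,\omega)\in Z^2_{ss}(G,N)$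 let $N\times_{(S,\omega)}G$ be the set $N\times G$ with the group multiplication $$(n,g)(n',g')=(n\,S(g)(n')\,\omega(g,g'),\,gg').$$ It carries a unique Lie group structure for which, for some open identity neighborhood $U\subseteq G$, the map $(n,g)\mapsto(n,g)$ is a diffeomorphism of the open subset $N\times U$ of the product manifold onto an open subset of $N\times_{(S,\omega)}G$. With this structure, $n\mapsto(n,1)$ and $(n,g)\mapsto g$, it is a Lie group extension of $G$ by $N$. **Theorem.** $C^1_s(G,N)$ is a group under pointwise multiplication, and it acts on $Z^2_{ss}(G,N)$ by $$h.(S,\omega)=(h.S,\;h*_S\omega),\qquad (h.S)(g)=C_N(h(g))\,S(g),\qquad (h*_S\omega)(g,g')=h(g)\,S(g)(h(g'))\,\omega(g,g')\,h(gg')^{-1}.$$ (a) For $(S,\omega),(S',\omega')\in Z^2_{ss}(G,N)$, the extensions $N\times_{(S,\omega)}G$ and $N\times_{(S',\omega')}G$ are equivalent if and only if there is $h\in C^1_s(G,N)$ with $h.(S,\omega)=(S',\omega')$. (b) If $h\in C^1_s(G,N)$ satisfies $h.(S,\omega)=(S',\omega')$, then $$\varphi: N\times_{(S',\omega')}G\to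 N\times_{(S,\omega)}G,\qquad \varphi(n,g)=(n\,h(g),g),$$ is an equivalence of extensions; and every equivalence of extensions $N\times_{(S',\omega')}G\to N\times_{(S,\omega)}G$ has this form for some such $h$. (c) The map $Z^2_{ss}(G,N)\to\mathrm{Ext}(G,N)$, $(S,\omega)\mapsto[N\times_{(S,\omega)}G]$, induces a bijection $Z^2_{ss}(G,N)/C^1_s(G,N)\to\mathrm{Ext}(G,N)$. -/

import Mathlib

open Set Filter Topology

universe w w₁ w₂ w₃ u v

/-! ### Smooth maps between locally convex spaces (Michal-Bastiani calculus) -/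

/-- `f` is of class `C^n` on the open set `U`: it is continuous on `U` and, if `n = m + 1`, all
directional derivatives `df (x, h) = lim_{t → 0} t⁻¹ (f (x + t h) - f x)`, `x ∈ U`, exist and
`df` is of class `C^m` on `U × X`. -/
def MBContDiffOn (𝕜 : Type w) [RCLike 𝕜] {Y : Type w₂} [AddCommGroup Y] [Module 𝕜 Y]
    [TopologicalSpace Y] : (n : ℕ) → {X : Type w₁} → [AddCommGroup X] → [Module 𝕜 X] →
    [TopologicalSpace X] → (X → Y) → Set X → Prop
  | 0, _, _, _, _, f, U => ContinuousOn f U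
  | n + 1, X, _, _, _, f, U => ContinuousOn f U ∧ ∃ df : X × X → Y,
      (∀ x ∈ U, ∀ h : X,
        Tendsto (fun t : 𝕜 => t⁻¹ • (f (x + t • h) - f x)) (𝓝[≠] 0) (𝓝 (df (x, h)))) ∧
      MBContDiffOn 𝕜 n df (U ×ˢ univ)

/-- `f` is smooth on the open set `U` if it is of class `C^n` there for all `n`. -/
def MBSmoothOn (𝕜 : Type w) [RCLike 𝕜] {X : Type w₁} [AddCommGroup X] [Module 𝕜 X]
    [TopologicalSpace X] {Y : Type w₂} [AddCommGroup Y] [Module 𝕜 Y] [TopologicalSpace Y]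
    (f : X → Y) (U : Set X) : Prop :=
  ∀ n : ℕ, MBContDiffOn 𝕜 n f U

/-! ### Smooth manifolds and Lie groups modeled on locally convex spaces -/

/-- The charted space `M` is a smooth manifold: all changes of charts are smooth. -/
def IsMBManifold (𝕜 : Type w) [RCLike 𝕜] (E : Type w₁) [AddCommGroup E] [Module 𝕜 E]
    [TopologicalSpace E] (M : Type u) [TopologicalSpace M] [ChartedSpace E M] : Prop :=
  ∀ e ∈ atlas E M, ∀ e' ∈ atlas E M, MBSmoothOn 𝕜 (e.symm.trans e') (e.symm.trans e').source

/-- The product charts on a product of two charted spaces, with values in the product of the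
models. -/
instance prodChartedSpaceProd (E : Type w₁) [TopologicalSpace E] (M : Type u) [TopologicalSpace M]
    [ChartedSpace E M] (F : Type w₂) [TopologicalSpace F] (M' : Type v) [TopologicalSpace M']
    [ChartedSpace F M'] : ChartedSpace (E × F) (M × M') :=
  prodChartedSpace E M F M'

/-- The map `f` between charted spaces is smooth on the open set `s`: it is continuous there and
all its expressions in charts are smooth. -/
def ManSmoothOn (𝕜 : Type w) [RCLike 𝕜] (E : Type w₁) [AddCommGroup E] [Module 𝕜 E]
    [TopologicalSpace E] (F : Type w₂) [AddCommGroup F] [Module 𝕜 F] [TopologicalSpace F]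
    {M : Type u} [TopologicalSpace M] [ChartedSpace E M]
    {M' : Type v} [TopologicalSpace M'] [ChartedSpace F M'] (f : M → M') (s : Set M) : Prop :=
  ContinuousOn f s ∧ ∀ e ∈ atlas E M, ∀ e' ∈ atlas F M',
    MBSmoothOn 𝕜 (fun x => e' (f (e.symm x))) (e.target ∩ e.symm ⁻¹' (s ∩ f ⁻¹' e'.source))

/-- `f` restricts to a diffeomorphism from the open set `s` onto the open set `t`. -/
def IsDiffeoOn (𝕜 : Type w) [RCLike 𝕜] (E : Type w₁) [AddCommGroup E] [Module 𝕜 E]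
    [TopologicalSpace E] (F : Type w₂) [AddCommGroup F] [Module 𝕜 F] [TopologicalSpace F]
    {M : Type u} [TopologicalSpace M] [ChartedSpace E M]
    {M' : Type v} [TopologicalSpace M'] [ChartedSpace F M'] (f : M → M')
    (s : Set M) (t : Set M') : Prop :=
  IsOpen s ∧ IsOpen t ∧ BijOn f s t ∧ ManSmoothOn 𝕜 E F f s ∧
    ∃ f' : M' → M, InvOn f' f s t ∧ ManSmoothOn 𝕜 F E f' t

/-- `G` is a Lie group modeled on the topological vector space `E`. -/
class IsMBLieGroup (𝕜 : Type w) [RCLike 𝕜] (E : Type w₁) [AddCommGroup E] [Module 𝕜 E]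
    [TopologicalSpace E] (G : Type u) [Group G] [TopologicalSpace G] [ChartedSpace E G] :
    Prop where
  isManifold : IsMBManifold 𝕜 E G
  smooth_mul : ManSmoothOn 𝕜 (E × E) E (fun p : G × G => p.1 * p.2) univ
  smooth_inv : ManSmoothOn 𝕜 E E (fun g : G => g⁻¹) univ

/-! ### Locally smooth cochains -/

section Cochains

variable (𝕜 : Type w) [RCLike 𝕜]
  (EG : Type w₁) [AddCommGroup EG] [Module 𝕜 EG] [TopologicalSpace EG]
  (EN : Type w₂) [AddCommGroup EN] [Module 𝕜 EN] [TopologicalSpace EN]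
  {G : Type u} [Group G] [TopologicalSpace G] [ChartedSpace EG G]
  {N : Type v} [Group N] [TopologicalSpace N] [ChartedSpace EN N]

/-- `f` is smooth on an open neighborhood of the identity. -/
def LocallySmooth (f : G → N) : Prop :=
  ∃ U : Set G, IsOpen U ∧ 1 ∈ U ∧ ManSmoothOn 𝕜 EG EN f U

/-- `C^1_s(G,N)`: locally smooth normalized maps `G → N`. -/
def IsC1s (h : G → N) : Prop :=
  LocallySmooth 𝕜 EG EN h ∧ h 1 = 1

/-- `C^2_s(G,N)`: locally smooth normalized maps `G × G → N`. -/
def IsC2s (ω : G → G → N) : Prop :=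
  LocallySmooth 𝕜 (EG × EG) EN (fun p : G × G => ω p.1 p.2) ∧ ∀ g, ω g 1 = 1 ∧ ω 1 g = 1

/-- `C^2_ss(G,N)`: those `ω ∈ C^2_s(G,N)` for which every map
`ω_g (x) = ω(g,x) ω(g x g⁻¹, g)⁻¹` is smooth on an identity neighborhood. -/
def IsC2ss (ω : G → G → N) : Prop :=
  IsC2s 𝕜 EG EN ω ∧
    ∀ g : G, LocallySmooth 𝕜 EG EN (fun x : G => ω g x * (ω (g * x * g⁻¹) g)⁻¹)

/-- `φ` is an automorphism of the Lie group `N`. -/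
def IsLieAut (φ : MulAut N) : Prop :=
  ManSmoothOn 𝕜 EN EN (φ : N → N) univ ∧ ManSmoothOn 𝕜 EN EN (φ.symm : N → N) univ

/-- `C^1_s(G, Aut N)`: maps `S` from `G` to the Lie group automorphisms of `N` with `S 1 = id`
for which `(g, n) ↦ S g n` is smooth on `U × N` for some open identity neighborhood `U`. -/
def IsC1sAut (S : G → MulAut N) : Prop :=
  (∀ g, IsLieAut 𝕜 EN (S g)) ∧ S 1 = 1 ∧
    ∃ U : Set G, IsOpen U ∧ 1 ∈ U ∧
      ManSmoothOn 𝕜 (EG × EN) EN (fun p : G × N => S p.1 p.2) (U ×ˢ univ)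

end Cochains

/-- `h.S = (C_N ∘ h) · S`. -/
def actS {G : Type u} {N : Type v} [Group N] (h : G → N) (S : G → MulAut N) : G → MulAut N :=
  fun g => MulAut.conj (h g) * S g

/-- `(h *_S ω)(g,g') = h(g) S(g)(h(g')) ω(g,g') h(gg')⁻¹`. -/
def actOmega {G : Type u} [Group G] {N : Type v} [Group N] (h : G → N) (S : G → MulAut N)
    (ω : G → G → N) : G → G → N :=
  fun g g' => h g * S g (h g') * ω g g' * (h (g * g'))⁻¹

/-- Smooth factor systems: the elements `(S, ω)` of `Z^2_ss(G,N)`, where `δ_S = C_N ∘ ω` and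
`d_S ω = 1`. -/
@[ext]
structure SmoothFactorSystem (𝕜 : Type w) [RCLike 𝕜]
    (EG : Type w₁) [AddCommGroup EG] [Module 𝕜 EG] [TopologicalSpace EG]
    (EN : Type w₂) [AddCommGroup EN] [Module 𝕜 EN] [TopologicalSpace EN]
    (G : Type u) [Group G] [TopologicalSpace G] [ChartedSpace EG G]
    (N : Type v) [Group N] [TopologicalSpace N] [ChartedSpace EN N] where
  S : G → MulAut N
  ω : G → G → N
  isC1sAut : IsC1sAut 𝕜 EG EN S
  isC2ss : IsC2ss 𝕜 EG EN ω
  delta_eq : ∀ g g' : G, S g * S g' * (S (g * g'))⁻¹ = MulAut.conj (ω g g')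
  d_eq_one : ∀ g g' g'' : G,
    S g (ω g' g'') * ω g (g' * g'') * (ω (g * g') g'')⁻¹ * (ω g g')⁻¹ = 1

/-! ### Extensions of Lie groups -/

section Extensions

variable (𝕜 : Type w) [RCLike 𝕜]
  (EG : Type w₁) [AddCommGroup EG] [Module 𝕜 EG] [TopologicalSpace EG]
  (EN : Type w₂) [AddCommGroup EN] [Module 𝕜 EN] [TopologicalSpace EN]

/-- `1 → N → Ĝ → G → 1` is an extension of Lie groups: a short exact sequence of morphisms of Lie
groups that makes `Ĝ` a smooth principal bundle over `G` for the right action `x.n = x ι(n)`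
of `N`. Its local trivializations `(x, n) ↦ σ(x) ι(n)` are given by smooth local sections `σ`. -/
structure IsLieGroupExtension (E : Type w₃) [AddCommGroup E] [Module 𝕜 E] [TopologicalSpace E]
    {G : Type u} [Group G] [TopologicalSpace G] [ChartedSpace EG G]
    {N : Type v} [Group N] [TopologicalSpace N] [ChartedSpace EN N]
    {Ghat : Type*} [Group Ghat] [TopologicalSpace Ghat] [ChartedSpace E Ghat]
    (ι : N →* Ghat) (q : Ghat →* G) : Prop where
  isLieGroup : IsMBLieGroup 𝕜 E Ghat
  smooth_incl : ManSmoothOn 𝕜 EN E ι univ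
  smooth_proj : ManSmoothOn 𝕜 E EG q univ
  injective : Function.Injective ι
  surjective : Function.Surjective q
  exact : ι.range = q.ker
  locallyTrivial : ∀ g : G, ∃ U : Set G, IsOpen U ∧ g ∈ U ∧ ∃ σ : G → Ghat,
    ManSmoothOn 𝕜 EG E σ U ∧ (∀ x ∈ U, q (σ x) = x) ∧
    IsDiffeoOn 𝕜 (EG × EN) E (fun p : G × N => σ p.1 * ι p.2) (U ×ˢ univ) (q ⁻¹' U)

/-- `φ` is an equivalence of extensions: a morphism of Lie groups that induces the identity
on `N` and on `G`. -/
structure IsExtEquivalence (E₁ : Type*) [AddCommGroup E₁] [Module 𝕜 E₁] [TopologicalSpace E₁]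
    (E₂ : Type*) [AddCommGroup E₂] [Module 𝕜 E₂] [TopologicalSpace E₂]
    {G : Type u} [Group G] {N : Type v} [Group N]
    {G₁ : Type*} [Group G₁] [TopologicalSpace G₁] [ChartedSpace E₁ G₁]
    {G₂ : Type*} [Group G₂] [TopologicalSpace G₂] [ChartedSpace E₂ G₂]
    (ι₁ : N →* G₁) (q₁ : G₁ →* G) (ι₂ : N →* G₂) (q₂ : G₂ →* G) (φ : G₁ →* G₂) : Prop where
  smooth : ManSmoothOn 𝕜 E₁ E₂ φ univ
  comp_incl : ∀ n, φ (ι₁ n) = ι₂ n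
  proj_comp : ∀ x, q₂ (φ x) = q₁ x

/-- Lie group extensions of `G` by `N`, with the Lie group in the middle modeled on some
locally convex Hausdorff space. -/
structure LieExtension
    (G : Type u) [Group G] [TopologicalSpace G] [ChartedSpace EG G]
    (N : Type v) [Group N] [TopologicalSpace N] [ChartedSpace EN N] where
  Model : Type (max w₁ w₂)
  [addCommGroup : AddCommGroup Model]
  [module : Module 𝕜 Model]
  [topModel : TopologicalSpace Model]
  [polynormable : PolynormableSpace 𝕜 Model]
  [t2 : T2Space Model]
  Carrier : Type (max u v)
  [group : Group Carrier]
  [topCarrier : TopologicalSpace Carrier]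
  [charted : ChartedSpace Model Carrier]
  incl : N →* Carrier
  proj : Carrier →* G
  isExtension : IsLieGroupExtension 𝕜 EG EN Model incl proj

attribute [instance] LieExtension.addCommGroup LieExtension.module LieExtension.topModel
  LieExtension.polynormable LieExtension.t2 LieExtension.group LieExtension.topCarrier
  LieExtension.charted

variable {𝕜 EG EN} in
/-- Two extensions are equivalent if there is an equivalence from the first to the second. -/
def LieExtension.Equivalent
    {G : Type u} [Group G] [TopologicalSpace G] [ChartedSpace EG G]
    {N : Type v} [Group N] [TopologicalSpace N] [ChartedSpace EN N]
    (X Y : LieExtension 𝕜 EG EN G N) : Prop :=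
  ∃ φ : X.Carrier →* Y.Carrier,
    IsExtEquivalence 𝕜 X.Model Y.Model X.incl X.proj Y.incl Y.proj φ

/-- `Ext(G,N)`: the set of equivalence classes of Lie group extensions of `G` by `N`. -/
def LieExt
    (G : Type u) [Group G] [TopologicalSpace G] [ChartedSpace EG G]
    (N : Type v) [Group N] [TopologicalSpace N] [ChartedSpace EN N] :=
  Quot (LieExtension.Equivalent (𝕜 := 𝕜) (EG := EG) (EN := EN) (G := G) (N := N))

end Extensions

/-! ### The extension defined by a smooth factor system -/

section TwistedProduct

variable {𝕜 : Type w} [RCLike 𝕜]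
  {EG : Type w₁} [AddCommGroup EG] [Module 𝕜 EG] [TopologicalSpace EG]
  {EN : Type w₂} [AddCommGroup EN] [Module 𝕜 EN] [TopologicalSpace EN]
  {G : Type u} [Group G] [TopologicalSpace G] [ChartedSpace EG G]
  {N : Type v} [Group N] [TopologicalSpace N] [ChartedSpace EN N]

/-- The set `N × G`, underlying the group `N ×_(S,ω) G`. -/
@[ext]
structure TwistedProduct (f : SmoothFactorSystem 𝕜 EG EN G N) where
  fst : N
  snd : G

namespace TwistedProduct

variable {f : SmoothFactorSystem 𝕜 EG EN G N}

/-- `(n,g)(n',g') = (n S(g)(n') ω(g,g'), gg')`. -/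
instance : Mul (TwistedProduct f) :=
  ⟨fun x y => ⟨x.fst * f.S x.snd y.fst * f.ω x.snd y.snd, x.snd * y.snd⟩⟩

instance : One (TwistedProduct f) := ⟨⟨1, 1⟩⟩

instance : Inv (TwistedProduct f) :=
  ⟨fun x => ⟨(f.ω x.snd⁻¹ x.snd)⁻¹ * f.S x.snd⁻¹ x.fst⁻¹, x.snd⁻¹⟩⟩

theorem mul_def (x y : TwistedProduct f) :
    x * y = ⟨x.fst * f.S x.snd y.fst * f.ω x.snd y.snd, x.snd * y.snd⟩ := rfl

theorem one_def : (1 : TwistedProduct f) = ⟨1, 1⟩ := rfl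

theorem inv_def (x : TwistedProduct f) :
    x⁻¹ = ⟨(f.ω x.snd⁻¹ x.snd)⁻¹ * f.S x.snd⁻¹ x.fst⁻¹, x.snd⁻¹⟩ := rfl

theorem S_S (f : SmoothFactorSystem 𝕜 EG EN G N) (g g' : G) (n : N) :
    f.S g (f.S g' n) = f.ω g g' * f.S (g * g') n * (f.ω g g')⁻¹ := by
  have h := f.delta_eq g g'
  rw [mul_inv_eq_iff_eq_mul] at h
  simpa using congrArg (fun φ : MulAut N => φ n) h

theorem S_omega (f : SmoothFactorSystem 𝕜 EG EN G N) (g g' g'' : G) :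
    f.S g (f.ω g' g'') * f.ω g (g' * g'') = f.ω g g' * f.ω (g * g') g'' := by
  have h := f.d_eq_one g g' g''
  rwa [mul_inv_eq_one, mul_inv_eq_iff_eq_mul] at h

instance : Group (TwistedProduct f) :=
  Group.ofLeftAxioms
    (by
      intro x y z
      ext
      · simp only [mul_def, map_mul, S_S, mul_assoc, S_omega, inv_mul_cancel_left]
      · simp only [mul_def, mul_assoc])
    (by
      intro x
      ext
      · simp [mul_def, one_def, f.isC1sAut.2.1, (f.isC2ss.1.2 x.snd).2]
      · simp [mul_def, one_def])
    (by
      intro x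
      ext
      · simp [mul_def, one_def, inv_def]
      · simp [mul_def, one_def, inv_def])

/-- The inclusion `n ↦ (n, 1)`. -/
def inclHom (f : SmoothFactorSystem 𝕜 EG EN G N) : N →* TwistedProduct f where
  toFun n := ⟨n, 1⟩
  map_one' := rfl
  map_mul' n n' := by
    ext
    · simp [mul_def, f.isC1sAut.2.1, (f.isC2ss.1.2 1).1]
    · simp [mul_def]

/-- The projection `(n, g) ↦ g`. -/
def projHom (f : SmoothFactorSystem 𝕜 EG EN G N) : TwistedProduct f →* G where
  toFun x := x.snd
  map_one' := rfl
  map_mul' _ _ := rfl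

end TwistedProduct

/-- The Lie group structure on `N ×_(S,ω) G`: for some open identity neighborhood `U` of `G`, the
map `(n, g) ↦ (n, g)` restricts to a diffeomorphism of the open set `N × U` of the product manifold
`N × G` onto an open subset of `N ×_(S,ω) G`. -/
structure TwistedLieStructure (f : SmoothFactorSystem 𝕜 EG EN G N) where
  Model : Type (max w₁ w₂)
  [addCommGroup : AddCommGroup Model]
  [module : Module 𝕜 Model]
  [topModel : TopologicalSpace Model]
  [polynormable : PolynormableSpace 𝕜 Model]
  [t2 : T2Space Model]
  [top : TopologicalSpace (TwistedProduct f)]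
  [charted : ChartedSpace Model (TwistedProduct f)]
  isLieGroup : IsMBLieGroup 𝕜 Model (TwistedProduct f)
  isDiffeoOn : ∃ U : Set G, IsOpen U ∧ 1 ∈ U ∧
    IsDiffeoOn 𝕜 (EN × EG) Model (fun p : N × G => (⟨p.1, p.2⟩ : TwistedProduct f))
      (univ ×ˢ U) {x | x.snd ∈ U}

namespace TwistedLieStructure

variable {f : SmoothFactorSystem 𝕜 EG EN G N}

attribute [instance] addCommGroup module topModel polynormable t2

/-- The group `N ×_(S,ω) G` endowed with the topology and the charts of `L`. -/
def Carrier (_L : TwistedLieStructure f) := TwistedProduct f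

instance (L : TwistedLieStructure f) : Group L.Carrier :=
  inferInstanceAs (Group (TwistedProduct f))

instance (L : TwistedLieStructure f) : TopologicalSpace L.Carrier := L.top

instance (L : TwistedLieStructure f) : ChartedSpace L.Model L.Carrier := L.charted

/-- The element `(n, g)` of `N ×_(S,ω) G`. -/
def mk' (L : TwistedLieStructure f) (n : N) (g : G) : L.Carrier := TwistedProduct.mk n g

/-- The inclusion `n ↦ (n, 1)`. -/
def incl (L : TwistedLieStructure f) : N →* L.Carrier := TwistedProduct.inclHom f

/-- The projection `(n, g) ↦ g`. -/
def proj (L : TwistedLieStructure f) : L.Carrier →* G := TwistedProduct.projHom f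

/-- `N → N ×_(S,ω) G → G` is an extension of Lie groups. -/
def IsExtension (L : TwistedLieStructure f) : Prop :=
  IsLieGroupExtension 𝕜 EG EN L.Model L.incl L.proj

/-- `N ×_(S,ω) G` as an extension of `G` by `N`. -/
def toLieExtension (L : TwistedLieStructure f) (hL : L.IsExtension) :
    LieExtension 𝕜 EG EN G N where
  Model := L.Model
  Carrier := L.Carrier
  incl := L.incl
  proj := L.proj
  isExtension := hL

/-- `φ : N ×_f' G → N ×_f G` is an equivalence of extensions of `G` by `N`. -/
def IsEquivalence {f' f : SmoothFactorSystem 𝕜 EG EN G N} (L' : TwistedLieStructure f')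
    (L : TwistedLieStructure f) (φ : L'.Carrier →* L.Carrier) : Prop :=
  IsExtEquivalence 𝕜 L'.Model L.Model L'.incl L'.proj L.incl L.proj φ

end TwistedLieStructure

end TwistedProduct

/-!
Conjugation by a section `σ` of an extension with `σ(1) = 1`, together with the defect
`σ(g)σ(g')σ(gg')⁻¹`, forms a factor system, and `(n, g) ↦ ι(n)σ(g)` is an isomorphism of groups from
its twisted product onto the extension. If `σ` is smooth near `1`, then so is this isomorphism, and
a homomorphism of Lie groups that is smooth at `1` is smooth everywhere by translation.

Conversely, in the coordinates `(n, g)` the multiplication, the inversion and every conjugation of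
a twisted product are smooth near the identity, and left translations are smooth near every point
that they keep in a set `N × V`. The translates of this chart domain therefore fit together to a
Lie group structure, which is unique because the identity is smooth at `1` in both directions.

Finally, a morphism `φ` over `G` that is the identity on `N` satisfies
`φ(n, g) = φ(n, 1) φ(1, g) = (n h(g), g)`, where `h(g)` is the component of `φ(1, g)` in `N`. That
`φ` is multiplicative says exactly that `h` carries one factor system to the other.
-/

universe w₄ v₁ v₂

/-! ### Calculus in locally convex spaces -/

section Calculus

variable {𝕜 : Type w} [RCLike 𝕜]
  {X : Type w₁} [AddCommGroup X] [Module 𝕜 X]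
  {Y : Type w₂} [AddCommGroup Y] [Module 𝕜 Y] [TopologicalSpace Y]
  {Z : Type w₃} [AddCommGroup Z] [Module 𝕜 Z] [TopologicalSpace Z]

theorem seminorm_image_sub_le_of_tendsto_slope_right [IsTopologicalAddGroup Y] {p : Seminorm 𝕜 Y}
    (hp : Continuous p) {g g' : ℝ → Y} {a b C : ℝ} (hab : a ≤ b) (hg : ContinuousOn g (Icc a b))
    (hg' : ∀ s ∈ Ico a b,
      Tendsto (fun z : ℝ => (((z - s : ℝ) : 𝕜))⁻¹ • (g z - g s)) (𝓝[>] s) (𝓝 (g' s)))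
    (bound : ∀ s ∈ Ico a b, p (g' s) ≤ C) : p (g b - g a) ≤ C * (b - a) := by
  refine image_le_of_liminf_slope_right_le_deriv_boundary (f := fun s => p (g s - g a))
    (B := fun s => C * (s - a)) (B' := fun _ => C)
    (hp.comp_continuousOn (hg.sub continuousOn_const))
    (by simp) (by fun_prop) (fun s _ => ?_) (fun s hs r hr => ?_) (right_mem_Icc.2 hab)
  · simpa using (((hasDerivAt_id s).sub_const a).const_mul C).hasDerivWithinAt
  have hslope : ∀ᶠ z in 𝓝[>] s, p ((((z - s : ℝ) : 𝕜))⁻¹ • (g z - g s)) < r :=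
    ((hp.tendsto _).comp (hg' s hs)).eventually_lt_const ((bound s hs).trans_lt hr)
  refine Eventually.frequently ?_
  filter_upwards [hslope, self_mem_nhdsWithin] with z hz hsz
  have hzs : 0 < z - s := sub_pos.2 hsz
  calc slope (fun s => p (g s - g a)) s z = (z - s)⁻¹ * (p (g z - g a) - p (g s - g a)) := by
        rw [slope_def_field, div_eq_inv_mul]
    _ ≤ (z - s)⁻¹ * p (g z - g s) := by
        gcongr
        rw [sub_le_iff_le_add]
        simpa using map_add_le_add p (g z - g s) (g s - g a)
    _ = p ((((z - s : ℝ) : 𝕜))⁻¹ • (g z - g s)) := by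
        rw [map_smul_eq_mul, norm_inv, RCLike.norm_ofReal, abs_of_pos hzs]
    _ < r := hz

theorem tendsto_ofReal_sub_mul_nhdsNE (s : ℝ) {t : 𝕜} (ht : t ≠ 0) :
    Tendsto (fun z : ℝ => ((z - s : ℝ) : 𝕜) * t) (𝓝[>] s) (𝓝[≠] 0) := by
  have hcont : Continuous fun z : ℝ => ((z - s : ℝ) : 𝕜) * t := by fun_prop
  refine tendsto_nhdsWithin_iff.2
    ⟨(hcont.tendsto' s 0 (by simp)).mono_left nhdsWithin_le_nhds, ?_⟩
  filter_upwards [self_mem_nhdsWithin] with z hz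
  exact mul_ne_zero (RCLike.ofReal_ne_zero.2 (sub_pos.2 hz).ne') ht

theorem seminorm_slope_sub_le_of_segment [IsTopologicalAddGroup Y] [ContinuousSMul 𝕜 Y]
    {p : Seminorm 𝕜 Y} (hp : Continuous p) {f : X → Y} {df : X × X → Y} {x h : X} {t : 𝕜}
    (ht : t ≠ 0) {y : Y} {ε : ℝ}
    (hf : ContinuousOn (fun s : ℝ => f (x + ((s : 𝕜) * t) • h)) (Icc 0 1))
    (hdf : ∀ s ∈ Icc (0 : ℝ) 1, Tendsto
      (fun r : 𝕜 => r⁻¹ • (f (x + ((s : 𝕜) * t) • h + r • h) - f (x + ((s : 𝕜) * t) • h))) (𝓝[≠] 0)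
      (𝓝 (df (x + ((s : 𝕜) * t) • h, h))))
    (bound : ∀ s ∈ Icc (0 : ℝ) 1, p (df (x + ((s : 𝕜) * t) • h, h) - y) ≤ ε) :
    p (t⁻¹ • (f (x + t • h) - f x) - y) ≤ ε := by
  let g : ℝ → Y := fun s => t⁻¹ • f (x + ((s : 𝕜) * t) • h) - (s : 𝕜) • y
  have hg : ContinuousOn g (Icc 0 1) := (hf.const_smul t⁻¹).sub (by fun_prop)
  have hg' : ∀ s ∈ Ico (0 : ℝ) 1,
      Tendsto (fun z : ℝ => (((z - s : ℝ) : 𝕜))⁻¹ • (g z - g s)) (𝓝[>] s)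
        (𝓝 (df (x + ((s : 𝕜) * t) • h, h) - y)) := fun s hs => by
    refine (((hdf s ⟨hs.1, hs.2.le⟩).comp
      (tendsto_ofReal_sub_mul_nhdsNE s ht)).sub_const y).congr' ?_
    filter_upwards [self_mem_nhdsWithin] with z hz
    have hzs : ((z - s : ℝ) : 𝕜) ≠ 0 := RCLike.ofReal_ne_zero.2 (sub_pos.2 hz).ne'
    have hpoint : x + ((s : 𝕜) * t) • h + (((z - s : ℝ) : 𝕜) * t) • h = x + ((z : 𝕜) * t) • h := by
      push_cast
      module
    have hsub : g z - g s = t⁻¹ • (f (x + ((z : 𝕜) * t) • h) - f (x + ((s : 𝕜) * t) • h)) -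
        ((z - s : ℝ) : 𝕜) • y := by
      simp only [g]
      push_cast
      module
    rw [Function.comp_apply, hpoint, hsub, mul_inv, mul_smul,
      smul_sub ((z - s : ℝ) : 𝕜)⁻¹ (t⁻¹ • _), inv_smul_smul₀ hzs]
  have hle := seminorm_image_sub_le_of_tendsto_slope_right hp zero_le_one hg hg'
    fun s hs => bound s ⟨hs.1, hs.2.le⟩
  have hends : g 1 - g 0 = t⁻¹ • (f (x + t • h) - f x) - y := by
    simp only [g, RCLike.ofReal_one, RCLike.ofReal_zero, one_mul, zero_mul, zero_smul, add_zero,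
      one_smul, sub_zero, smul_sub]
    abel
  simpa [hends] using hle

variable [TopologicalSpace X]

section

variable [IsTopologicalAddGroup X] [ContinuousSMul 𝕜 X]

theorem eventually_forall_segment {P : X × X → Prop} {x h : X} (hP : ∀ᶠ z in 𝓝 (x, h), P z) :
    ∀ᶠ q : X × 𝕜 in 𝓝 (h, 0), ∀ s ∈ Icc (0 : ℝ) 1, P (x + ((s : 𝕜) * q.2) • q.1, q.1) := by
  refine isCompact_Icc.eventually_forall_of_forall_eventually fun s _ => ?_
  have hcont : Continuous fun z : (X × 𝕜) × ℝ => (x + ((z.2 : 𝕜) * z.1.2) • z.1.1, z.1.1) := by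
    fun_prop
  exact (hcont.tendsto' ((h, 0), s) (x, h) (by simp)).eventually hP

theorem tendsto_slope_nhds_prod [PolynormableSpace 𝕜 Y] {f : X → Y} {df : X × X → Y} {U : Set X}
    (hU : IsOpen U) (hf : ContinuousOn f U)
    (hd : ∀ x ∈ U, ∀ h : X,
      Tendsto (fun t : 𝕜 => t⁻¹ • (f (x + t • h) - f x)) (𝓝[≠] 0) (𝓝 (df (x, h))))
    (hdf : ContinuousOn df (U ×ˢ univ)) {x : X} (hx : x ∈ U) (h : X) :
    Tendsto (fun q : X × 𝕜 => q.2⁻¹ • (f (x + q.2 • q.1) - f x)) (𝓝 h ×ˢ 𝓝[≠] 0)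
      (𝓝 (df (x, h))) := by
  have := (PolynormableSpace.withSeminorms 𝕜 Y).topologicalAddGroup
  have := (PolynormableSpace.withSeminorms 𝕜 Y).continuousSMul
  rw [(PolynormableSpace.withSeminorms 𝕜 Y).tendsto_nhds]
  rintro ⟨p, hp⟩ ε hε
  have hnear : ∀ᶠ z : X × X in 𝓝 (x, h), z.1 ∈ U ∧ p (df z - df (x, h)) < ε / 2 := by
    have hdfx : ContinuousAt df (x, h) :=
      hdf.continuousAt ((hU.prod isOpen_univ).mem_nhds ⟨hx, mem_univ _⟩)
    have hp0 : Tendsto (fun z => p (df z - df (x, h))) (𝓝 (x, h)) (𝓝 0) :=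
      (hp.tendsto' 0 0 (map_zero p)).comp (tendsto_sub_nhds_zero_iff.2 hdfx)
    exact ((hU.preimage continuous_fst).eventually_mem hx).and
      (hp0.eventually_lt_const (half_pos hε))
  have hsegment := eventually_forall_segment (𝕜 := 𝕜) hnear
  rw [nhds_prod_eq] at hsegment
  filter_upwards [hsegment.filter_mono (prod_mono_right _ nhdsWithin_le_nhds),
    tendsto_snd.eventually self_mem_nhdsWithin] with q hq ht
  refine (seminorm_slope_sub_le_of_segment hp ht ?_ (fun s hs => hd _ (hq s hs).1 _)
    fun s hs => (hq s hs).2.le).trans_lt (half_lt_self hε)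
  exact hf.comp (by fun_prop) fun s hs => (hq s hs).1

theorem eventually_add_smul_mem {U : Set X} (hU : IsOpen U) {x : X} (hx : x ∈ U) (h : X) :
    ∀ᶠ t : 𝕜 in 𝓝[≠] 0, x + t • h ∈ U := by
  have hcont : Continuous fun t : 𝕜 => x + t • h := by fun_prop
  exact ((hcont.tendsto' 0 x (by simp)).eventually (hU.eventually_mem hx)).filter_mono
    nhdsWithin_le_nhds

end

namespace MBContDiffOn

variable {n : ℕ} {f g : X → Y} {U V : Set X}

theorem continuousOn (hf : MBContDiffOn 𝕜 n f U) : ContinuousOn f U := by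
  cases n with
  | zero => exact hf
  | succ n => exact hf.1

theorem mono (hf : MBContDiffOn 𝕜 n f U) (hVU : V ⊆ U) : MBContDiffOn 𝕜 n f V := by
  induction n generalizing X with
  | zero => exact ContinuousOn.mono hf hVU
  | succ n ih =>
    obtain ⟨hc, df, hd, hdf⟩ := hf
    exact ⟨hc.mono hVU, df, fun x hx => hd x (hVU hx), ih hdf (prod_mono_left hVU)⟩

theorem of_succ (hf : MBContDiffOn 𝕜 (n + 1) f U) : MBContDiffOn 𝕜 n f U := by
  induction n generalizing X with
  | zero => exact hf.1
  | succ n ih =>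
    obtain ⟨hc, df, hd, hdf⟩ := hf
    exact ⟨hc, df, hd, ih hdf⟩

theorem congr [IsTopologicalAddGroup X] [ContinuousSMul 𝕜 X] (hf : MBContDiffOn 𝕜 n f U)
    (hU : IsOpen U) (hg : EqOn g f U) : MBContDiffOn 𝕜 n g U := by
  cases n with
  | zero => exact ContinuousOn.congr hf hg
  | succ n =>
    obtain ⟨hc, df, hd, hdf⟩ := hf
    refine ⟨hc.congr hg, df, fun x hx h => (hd x hx h).congr' ?_, hdf⟩
    filter_upwards [eventually_add_smul_mem hU hx h] with t ht
    rw [hg hx, hg ht]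

theorem of_locally [T2Space Y] [IsTopologicalAddGroup X] [ContinuousSMul 𝕜 X]
    (hf : ∀ x ∈ U, ∃ V, IsOpen V ∧ x ∈ V ∧ MBContDiffOn 𝕜 n f V) : MBContDiffOn 𝕜 n f U := by
  induction n generalizing X with
  | zero =>
    exact continuousOn_of_locally_continuousOn fun x hx =>
      let ⟨V, hV, hxV, hfV⟩ := hf x hx
      ⟨V, hV, hxV, ContinuousOn.mono hfV inter_subset_right⟩
  | succ n ih =>
    let df : X × X → Y := fun z =>
      limUnder (𝓝[≠] (0 : 𝕜)) fun t : 𝕜 => t⁻¹ • (f (z.1 + t • z.2) - f z.1)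
    refine ⟨continuousOn_of_locally_continuousOn fun x hx => ?_, df, fun x hx h => ?_,
      ih fun z hz => ?_⟩
    · obtain ⟨V, hV, hxV, hfV, -⟩ := hf x hx
      exact ⟨V, hV, hxV, hfV.mono inter_subset_right⟩
    · obtain ⟨V, -, hxV, -, df', hd', -⟩ := hf x hx
      exact tendsto_nhds_limUnder ⟨_, hd' x hxV h⟩
    · obtain ⟨V, hV, hxV, -, df', hd', hdf'⟩ := hf z.1 hz.1
      exact ⟨V ×ˢ univ, hV.prod isOpen_univ, ⟨hxV, mem_univ _⟩,
        hdf'.congr (hV.prod isOpen_univ) fun y hy => (hd' y.1 hy.1 y.2).limUnder_eq⟩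

theorem const (y : Y) (U : Set X) : MBContDiffOn 𝕜 n (fun _ : X => y) U := by
  induction n generalizing X y with
  | zero => exact continuousOn_const
  | succ n ih =>
    exact ⟨continuousOn_const, fun _ => 0, fun _ _ _ => by simp [tendsto_const_nhds], ih _ _⟩

theorem prodMk {g : X → Z} (hf : MBContDiffOn 𝕜 n f U) (hg : MBContDiffOn 𝕜 n g U) :
    MBContDiffOn 𝕜 n (fun x => (f x, g x)) U := by
  induction n generalizing X with
  | zero => exact ContinuousOn.prodMk hf hg
  | succ n ih =>
    obtain ⟨hc, df, hd, hdf⟩ := hf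
    obtain ⟨hc', dg, hd', hdg⟩ := hg
    exact ⟨hc.prodMk hc', fun z => (df z, dg z),
      fun x hx h => (hd x hx h).prodMk_nhds (hd' x hx h), ih hdf hdg⟩

theorem comp_continuousLinearMap {g : Y → Z} {V : Set Y} (hg : MBContDiffOn 𝕜 n g V)
    (L : X →L[𝕜] Y) (hUV : MapsTo L U V) : MBContDiffOn 𝕜 n (fun x => g (L x)) U := by
  induction n generalizing X Y with
  | zero => exact ContinuousOn.comp hg L.continuous.continuousOn hUV
  | succ n ih =>
    obtain ⟨hc, dg, hd, hdg⟩ := hg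
    exact ⟨hc.comp L.continuous.continuousOn hUV, fun z => dg (L.prodMap L z),
      fun x hx h => by simpa using hd (L x) (hUV hx) (L h),
      ih hdg (L.prodMap L) fun z hz => ⟨hUV hz.1, mem_univ _⟩⟩

theorem comp [IsTopologicalAddGroup Y] [ContinuousSMul 𝕜 Y] [PolynormableSpace 𝕜 Z]
    {g : Y → Z} {V : Set Y} (hg : MBContDiffOn 𝕜 n g V) (hf : MBContDiffOn 𝕜 n f U)
    (hV : IsOpen V) (hfUV : MapsTo f U V) : MBContDiffOn 𝕜 n (fun x => g (f x)) U := by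
  induction n generalizing X Y with
  | zero => exact ContinuousOn.comp hg hf hfUV
  | succ n ih =>
    have hfn := hf.of_succ
    obtain ⟨hc, df, hd, hdf⟩ := hf
    obtain ⟨hc', dg, hd', hdg⟩ := hg
    refine ⟨hc'.comp hc hfUV, fun z => dg (f z.1, df z), fun x hx h => ?_, ?_⟩
    · have hslope := tendsto_slope_nhds_prod hV hc' hd' hdg.continuousOn (hfUV hx) (df (x, h))
      refine (hslope.comp ((hd x hx h).prodMk tendsto_id)).congr' ?_
      filter_upwards [self_mem_nhdsWithin] with t ht
      simp [smul_inv_smul₀ (show t ≠ 0 from ht)]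
    · have hfst : MBContDiffOn 𝕜 n (fun z : X × X => f z.1) (U ×ˢ univ) :=
        hfn.comp_continuousLinearMap (ContinuousLinearMap.fst 𝕜 X X) fun z hz => hz.1
      exact ih hdg (hfst.prodMk hdf) (hV.prod isOpen_univ) fun z hz => ⟨hfUV hz.1, mem_univ _⟩

end MBContDiffOn

namespace MBSmoothOn

variable {f g : X → Y} {U V : Set X}

theorem continuousOn (hf : MBSmoothOn 𝕜 f U) : ContinuousOn f U := hf 0

theorem mono (hf : MBSmoothOn 𝕜 f U) (hVU : V ⊆ U) : MBSmoothOn 𝕜 f V :=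
  fun n => (hf n).mono hVU

theorem const (y : Y) (U : Set X) : MBSmoothOn 𝕜 (fun _ : X => y) U :=
  fun _ => MBContDiffOn.const y U

theorem prodMk {g : X → Z} (hf : MBSmoothOn 𝕜 f U) (hg : MBSmoothOn 𝕜 g U) :
    MBSmoothOn 𝕜 (fun x => (f x, g x)) U :=
  fun n => (hf n).prodMk (hg n)

theorem comp_continuousLinearMap {g : Y → Z} {V : Set Y} (hg : MBSmoothOn 𝕜 g V)
    (L : X →L[𝕜] Y) (hUV : MapsTo L U V) : MBSmoothOn 𝕜 (fun x => g (L x)) U :=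
  fun n => (hg n).comp_continuousLinearMap L hUV

theorem comp [PolynormableSpace 𝕜 Y] [PolynormableSpace 𝕜 Z] {g : Y → Z} {V : Set Y}
    (hg : MBSmoothOn 𝕜 g V) (hf : MBSmoothOn 𝕜 f U) (hV : IsOpen V) (hfUV : MapsTo f U V) :
    MBSmoothOn 𝕜 (fun x => g (f x)) U := by
  have := (PolynormableSpace.withSeminorms 𝕜 Y).topologicalAddGroup
  have := (PolynormableSpace.withSeminorms 𝕜 Y).continuousSMul
  exact fun n => (hg n).comp (hf n) hV hfUV

variable [PolynormableSpace 𝕜 X]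

theorem congr (hf : MBSmoothOn 𝕜 f U) (hU : IsOpen U) (hg : EqOn g f U) : MBSmoothOn 𝕜 g U := by
  have := (PolynormableSpace.withSeminorms 𝕜 X).topologicalAddGroup
  have := (PolynormableSpace.withSeminorms 𝕜 X).continuousSMul
  exact fun n => (hf n).congr hU hg

theorem of_locally [T2Space Y]
    (hf : ∀ x ∈ U, ∃ V, IsOpen V ∧ x ∈ V ∧ MBSmoothOn 𝕜 f V) : MBSmoothOn 𝕜 f U := by
  have := (PolynormableSpace.withSeminorms 𝕜 X).topologicalAddGroup
  have := (PolynormableSpace.withSeminorms 𝕜 X).continuousSMul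
  refine fun n => MBContDiffOn.of_locally fun x hx => ?_
  obtain ⟨V, hV, hxV, hfV⟩ := hf x hx
  exact ⟨V, hV, hxV, hfV n⟩

end MBSmoothOn

end Calculus

/-! ### Smooth maps between manifolds -/

theorem isOpen_target_inter_symm_preimage {H H' M M' : Type*} [TopologicalSpace H]
    [TopologicalSpace H'] [TopologicalSpace M] [TopologicalSpace M'] {f : M → M'} {s : Set M}
    (hf : ContinuousOn f s) (hs : IsOpen s) (e : OpenPartialHomeomorph M H)
    (e' : OpenPartialHomeomorph M' H') :
    IsOpen (e.target ∩ e.symm ⁻¹' (s ∩ f ⁻¹' e'.source)) :=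
  e.isOpen_inter_preimage_symm (hf.isOpen_inter_preimage hs e'.open_source)

/-- Class version of `IsMBManifold`, so that products of manifolds and Lie groups are found to be
manifolds by instance search. -/
class MBManifold (𝕜 : Type w) [RCLike 𝕜] (E : Type w₁) [AddCommGroup E] [Module 𝕜 E]
    [TopologicalSpace E] (M : Type u) [TopologicalSpace M] [ChartedSpace E M] : Prop where
  isManifold : IsMBManifold 𝕜 E M

section Manifolds

variable {𝕜 : Type w} [RCLike 𝕜]
  {E : Type w₁} [AddCommGroup E] [Module 𝕜 E] [TopologicalSpace E]
  {E' : Type w₂} [AddCommGroup E'] [Module 𝕜 E'] [TopologicalSpace E']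
  {E'' : Type w₃} [AddCommGroup E''] [Module 𝕜 E''] [TopologicalSpace E'']
  {M : Type u} [TopologicalSpace M] [ChartedSpace E M]
  {M' : Type v} [TopologicalSpace M'] [ChartedSpace E' M']
  {M'' : Type v₁} [TopologicalSpace M''] [ChartedSpace E'' M'']
  {f : M → M'} {g : M' → M''} {s : Set M} {t : Set M'} {x : M}

variable (𝕜 E E') in
/-- `f` is smooth on an open neighborhood of `x`. -/
def ManSmoothAt (f : M → M') (x : M) : Prop :=
  ∃ U : Set M, IsOpen U ∧ x ∈ U ∧ ManSmoothOn 𝕜 E E' f U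

theorem ManSmoothOn.mono {s' : Set M} (hf : ManSmoothOn 𝕜 E E' f s) (hs : s' ⊆ s) :
    ManSmoothOn 𝕜 E E' f s' :=
  ⟨hf.1.mono hs, fun e he e' he' => (hf.2 e he e' he').mono
    (inter_subset_inter_right _ (preimage_mono (inter_subset_inter_left _ hs)))⟩

theorem ManSmoothOn.manSmoothAt (hf : ManSmoothOn 𝕜 E E' f s) (hs : IsOpen s) (hx : x ∈ s) :
    ManSmoothAt 𝕜 E E' f x :=
  ⟨s, hs, hx, hf⟩

theorem ManSmoothOn.manSmoothAt_of_univ (hf : ManSmoothOn 𝕜 E E' f univ) (x : M) :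
    ManSmoothAt 𝕜 E E' f x :=
  hf.manSmoothAt isOpen_univ (mem_univ x)

theorem ManSmoothAt.continuousAt (hf : ManSmoothAt 𝕜 E E' f x) : ContinuousAt f x :=
  let ⟨_, hU, hxU, hfU⟩ := hf
  hfU.1.continuousAt (hU.mem_nhds hxU)

theorem manSmoothOn_const (c : M') (s : Set M) : ManSmoothOn 𝕜 E E' (fun _ => c) s :=
  ⟨continuousOn_const, fun _ _ _ _ => MBSmoothOn.const _ _⟩

theorem manSmoothAt_const (c : M') (x : M) : ManSmoothAt 𝕜 E E' (fun _ => c) x :=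
  (manSmoothOn_const c univ).manSmoothAt_of_univ x

theorem ManSmoothOn.prodMk {g : M → M''} (hf : ManSmoothOn 𝕜 E E' f s)
    (hg : ManSmoothOn 𝕜 E E'' g s) : ManSmoothOn 𝕜 E (E' × E'') (fun x => (f x, g x)) s := by
  refine ⟨hf.1.prodMk hg.1, ?_⟩
  rintro e he _ ⟨e', he', e'', he'', rfl⟩
  exact ((hf.2 e he e' he').mono fun x hx => ⟨hx.1, hx.2.1, hx.2.2.1⟩).prodMk
    ((hg.2 e he e'' he'').mono fun x hx => ⟨hx.1, hx.2.1, hx.2.2.2⟩)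

theorem ManSmoothAt.prodMk {g : M → M''} (hf : ManSmoothAt 𝕜 E E' f x)
    (hg : ManSmoothAt 𝕜 E E'' g x) : ManSmoothAt 𝕜 E (E' × E'') (fun x => (f x, g x)) x := by
  obtain ⟨U, hU, hxU, hfU⟩ := hf
  obtain ⟨V, hV, hxV, hgV⟩ := hg
  exact ⟨U ∩ V, hU.inter hV, ⟨hxU, hxV⟩,
    (hfU.mono inter_subset_left).prodMk (hgV.mono inter_subset_right)⟩

theorem manSmoothOn_id [MBManifold 𝕜 E M] (s : Set M) : ManSmoothOn 𝕜 E E (fun x : M => x) s :=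
  ⟨continuousOn_id, fun e he e' he' => (MBManifold.isManifold e he e' he').mono fun x hx => by
    rw [OpenPartialHomeomorph.trans_source, e.symm_source]
    exact ⟨hx.1, hx.2.2⟩⟩

theorem manSmoothAt_id [MBManifold 𝕜 E M] (x : M) : ManSmoothAt 𝕜 E E (fun x : M => x) x :=
  (manSmoothOn_id univ).manSmoothAt_of_univ x

theorem manSmoothOn_fst [MBManifold 𝕜 E M] (s : Set (M × M')) :
    ManSmoothOn 𝕜 (E × E') E (fun p : M × M' => p.1) s := by
  refine ⟨continuous_fst.continuousOn, ?_⟩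
  rintro _ ⟨e, he, e', -, rfl⟩ e₁ he₁
  refine (MBManifold.isManifold e he e₁ he₁).comp_continuousLinearMap
    (ContinuousLinearMap.fst 𝕜 E E') fun x hx => ?_
  rw [OpenPartialHomeomorph.trans_source, e.symm_source]
  exact ⟨hx.1.1, hx.2.2⟩

theorem manSmoothOn_snd [MBManifold 𝕜 E' M'] (s : Set (M × M')) :
    ManSmoothOn 𝕜 (E × E') E' (fun p : M × M' => p.2) s := by
  refine ⟨continuous_snd.continuousOn, ?_⟩
  rintro _ ⟨e, -, e', he', rfl⟩ e₁ he₁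
  refine (MBManifold.isManifold e' he' e₁ he₁).comp_continuousLinearMap
    (ContinuousLinearMap.snd 𝕜 E E') fun x hx => ?_
  rw [OpenPartialHomeomorph.trans_source, e'.symm_source]
  exact ⟨hx.1.2, hx.2.2⟩

instance MBManifold.prod [MBManifold 𝕜 E M] [MBManifold 𝕜 E' M'] :
    MBManifold 𝕜 (E × E') (M × M') where
  isManifold := by
    rintro _ ⟨e, he, e', he', rfl⟩ _ ⟨e₁, he₁, e₁', he₁', rfl⟩
    have hsource : ∀ x : E × E', x ∈ ((e.prod e').symm.trans (e₁.prod e₁')).source →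
        x.1 ∈ (e.symm.trans e₁).source ∧ x.2 ∈ (e'.symm.trans e₁').source := fun x hx => by
      simp only [OpenPartialHomeomorph.trans_source] at hx ⊢
      exact ⟨⟨hx.1.1, hx.2.1⟩, ⟨hx.1.2, hx.2.2⟩⟩
    exact ((MBManifold.isManifold e he e₁ he₁).comp_continuousLinearMap
      (ContinuousLinearMap.fst 𝕜 E E') fun x hx => (hsource x hx).1).prodMk
        ((MBManifold.isManifold e' he' e₁' he₁').comp_continuousLinearMap
          (ContinuousLinearMap.snd 𝕜 E E') fun x hx => (hsource x hx).2)

variable [PolynormableSpace 𝕜 E]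

theorem ManSmoothOn.congr {g : M → M'} (hf : ManSmoothOn 𝕜 E E' f s) (hs : IsOpen s)
    (hg : EqOn g f s) : ManSmoothOn 𝕜 E E' g s := by
  refine ⟨hf.1.congr hg, fun e he e' he' => ?_⟩
  rw [hg.inter_preimage_eq]
  exact (hf.2 e he e' he').congr (isOpen_target_inter_symm_preimage hf.1 hs e e') fun x hx => by
    rw [hg hx.2.1]

theorem ManSmoothAt.congr_of_eventuallyEq {g : M → M'} (hf : ManSmoothAt 𝕜 E E' f x)
    (hg : g =ᶠ[𝓝 x] f) : ManSmoothAt 𝕜 E E' g x := by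
  obtain ⟨U, hU, hxU, hfU⟩ := hf
  obtain ⟨V, hgV, hV, hxV⟩ := eventually_nhds_iff.1 hg
  exact ⟨U ∩ V, hU.inter hV, ⟨hxU, hxV⟩,
    (hfU.mono inter_subset_left).congr (hU.inter hV) fun y hy => hgV y hy.2⟩

theorem ManSmoothOn.of_forall_manSmoothAt [T2Space E'] (hf : ∀ x ∈ s, ManSmoothAt 𝕜 E E' f x) :
    ManSmoothOn 𝕜 E E' f s := by
  refine ⟨fun x hx => (hf x hx).continuousAt.continuousWithinAt,
    fun e he e' he' => MBSmoothOn.of_locally fun y hy => ?_⟩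
  obtain ⟨V, hV, hxV, hfV⟩ := hf _ hy.2.1
  exact ⟨_, isOpen_target_inter_symm_preimage hfV.1 hV e e', ⟨hy.1, hxV, hy.2.2⟩,
    hfV.2 e he e' he'⟩

variable [PolynormableSpace 𝕜 E'] [PolynormableSpace 𝕜 E''] [T2Space E'']

theorem ManSmoothOn.comp (hg : ManSmoothOn 𝕜 E' E'' g t) (hf : ManSmoothOn 𝕜 E E' f s)
    (ht : IsOpen t) (hs : IsOpen s) (hst : MapsTo f s t) :
    ManSmoothOn 𝕜 E E'' (fun x => g (f x)) s := by
  refine ⟨hg.1.comp hf.1 hst, fun e he e'' he'' => MBSmoothOn.of_locally fun y hy => ?_⟩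
  let e' := chartAt E' (f (e.symm y))
  have he' : e' ∈ atlas E' M' := chart_mem_atlas E' _
  have hy' : f (e.symm y) ∈ e'.source := mem_chart_source E' _
  have hg' := isOpen_target_inter_symm_preimage hg.1 ht e' e''
  have hf' := hf.2 e he e' he'
  have hopen :=
    hf'.continuousOn.isOpen_inter_preimage (isOpen_target_inter_symm_preimage hf.1 hs e e') hg'
  refine ⟨_, hopen, ⟨⟨hy.1, hy.2.1, hy'⟩, e'.map_source hy', ?_⟩, ?_⟩
  · simp only [mem_preimage, e'.left_inv hy']
    exact ⟨hst hy.2.1, hy.2.2⟩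
  · refine ((hg.2 e' he' e'' he'').comp (hf'.mono inter_subset_left) hg' fun x hx => hx.2).congr
      hopen fun x hx => ?_
    simp only [e'.left_inv hx.1.2.2]

theorem ManSmoothAt.comp (x : M) (hg : ManSmoothAt 𝕜 E' E'' g (f x))
    (hf : ManSmoothAt 𝕜 E E' f x) : ManSmoothAt 𝕜 E E'' (fun x => g (f x)) x := by
  obtain ⟨V, hV, hxV, hgV⟩ := hg
  obtain ⟨U, hU, hxU, hfU⟩ := hf
  have hopen := hfU.1.isOpen_inter_preimage hU hV
  exact ⟨_, hopen, ⟨hxU, hxV⟩, hgV.comp (hfU.mono inter_subset_left) hV hopen fun y hy => hy.2⟩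

theorem ManSmoothAt.comp_of_eq {y : M'} (hg : ManSmoothAt 𝕜 E' E'' g y)
    (hf : ManSmoothAt 𝕜 E E' f x) (hy : f x = y) : ManSmoothAt 𝕜 E E'' (fun x => g (f x)) x := by
  subst hy
  exact hg.comp x hf

omit [T2Space E''] in
theorem ManSmoothAt.fst [T2Space E'] [MBManifold 𝕜 E' M'] {f : M → M' × M''}
    (hf : ManSmoothAt 𝕜 E (E' × E'') f x) : ManSmoothAt 𝕜 E E' (fun x => (f x).1) x :=
  ((manSmoothOn_fst univ).manSmoothAt_of_univ (f x)).comp x hf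

theorem ManSmoothAt.snd [MBManifold 𝕜 E'' M''] {f : M → M' × M''}
    (hf : ManSmoothAt 𝕜 E (E' × E'') f x) : ManSmoothAt 𝕜 E E'' (fun x => (f x).2) x :=
  ((manSmoothOn_snd univ).manSmoothAt_of_univ (f x)).comp x hf

end Manifolds

/-! ### Lie groups -/

section LieGroups

theorem IsMBLieGroup.isTopologicalGroup (𝕜 : Type w) [RCLike 𝕜] (E : Type w₁) [AddCommGroup E]
    [Module 𝕜 E] [TopologicalSpace E] (G : Type u) [Group G] [TopologicalSpace G]
    [ChartedSpace E G] [IsMBLieGroup 𝕜 E G] : IsTopologicalGroup G where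
  continuous_mul := continuousOn_univ.1 (IsMBLieGroup.smooth_mul (𝕜 := 𝕜) (E := E)).1
  continuous_inv := continuousOn_univ.1 (IsMBLieGroup.smooth_inv (𝕜 := 𝕜) (E := E)).1

variable {𝕜 : Type w} [RCLike 𝕜]
  {E : Type w₁} [AddCommGroup E] [Module 𝕜 E] [TopologicalSpace E]
  {E' : Type w₂} [AddCommGroup E'] [Module 𝕜 E'] [TopologicalSpace E']
  {M : Type u} [TopologicalSpace M] [ChartedSpace E M]
  {H : Type v} [Group H] [TopologicalSpace H] [ChartedSpace E' H] [IsMBLieGroup 𝕜 E' H]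

instance (priority := low) IsMBLieGroup.toMBManifold : MBManifold 𝕜 E' H :=
  ⟨IsMBLieGroup.isManifold⟩

variable [PolynormableSpace 𝕜 E] [PolynormableSpace 𝕜 E'] [T2Space E']

theorem ManSmoothAt.mul {f g : M → H} {x : M} (hf : ManSmoothAt 𝕜 E E' f x)
    (hg : ManSmoothAt 𝕜 E E' g x) : ManSmoothAt 𝕜 E E' (fun x => f x * g x) x :=
  (IsMBLieGroup.smooth_mul.manSmoothAt_of_univ (f x, g x)).comp x (hf.prodMk hg)

theorem ManSmoothAt.inv {f : M → H} {x : M} (hf : ManSmoothAt 𝕜 E E' f x) :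
    ManSmoothAt 𝕜 E E' (fun x => (f x)⁻¹) x :=
  (IsMBLieGroup.smooth_inv.manSmoothAt_of_univ (f x)).comp x hf

variable [T2Space E] {G : Type v₁} [Group G] [TopologicalSpace G] [ChartedSpace E G]
  [IsMBLieGroup 𝕜 E G]

theorem manSmoothOn_univ_of_manSmoothAt_one (φ : G →* H) (hφ : ManSmoothAt 𝕜 E E' φ 1) :
    ManSmoothOn 𝕜 E E' φ univ := by
  refine .of_forall_manSmoothAt fun a _ => ?_
  have htranslate : ManSmoothAt 𝕜 E E' (fun x => φ a * φ (a⁻¹ * x)) a :=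
    (manSmoothAt_const _ _).mul
      (hφ.comp_of_eq ((manSmoothAt_const _ _).mul (manSmoothAt_id a)) (inv_mul_cancel a))
  simpa only [← map_mul, mul_inv_cancel_left] using htranslate

end LieGroups

/-! ### Lie groups from local data -/

/-- Data on a group `K`, identified by a bijection with a manifold `P`, that make `K` a Lie group:
on an open subset `nhd` of `P` containing the identity all left translations are smooth where they
stay in `nhd`, and multiplication, inversion and all conjugations are smooth at the identity. The
bijection is not assumed to be a homeomorphism for any topology on `K`; only its restriction to
`nhd` will become one. -/
structure LocalLieData (𝕜 : Type w) [RCLike 𝕜]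
    (E : Type w₁) [AddCommGroup E] [Module 𝕜 E] [TopologicalSpace E]
    (P : Type u) [TopologicalSpace P] [ChartedSpace E P] (K : Type v) [Group K] where
  equiv : P ≃ K
  nhd : Set P
  isOpen_nhd : IsOpen nhd
  one_mem : equiv.symm 1 ∈ nhd
  smooth_left : ∀ k : K, ∀ p ∈ nhd, equiv.symm (k * equiv p) ∈ nhd →
    ManSmoothAt 𝕜 E E (fun p => equiv.symm (k * equiv p)) p
  smooth_mul : ManSmoothAt 𝕜 (E × E) E
    (fun p : P × P => equiv.symm (equiv p.1 * equiv p.2)) (equiv.symm 1, equiv.symm 1)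
  smooth_inv : ManSmoothAt 𝕜 E E (fun p => equiv.symm (equiv p)⁻¹) (equiv.symm 1)
  smooth_conj : ∀ k : K, ManSmoothAt 𝕜 E E
    (fun p => equiv.symm (k * equiv p * k⁻¹)) (equiv.symm 1)

namespace LocalLieData

variable {𝕜 : Type w} [RCLike 𝕜]
  {E : Type w₁} [AddCommGroup E] [Module 𝕜 E] [TopologicalSpace E]
  {P : Type u} [TopologicalSpace P] [ChartedSpace E P] {K : Type v} [Group K]
  (D : LocalLieData 𝕜 E P K)

/-- The group `K`, as a type that carries the Lie group structure defined by the local data. -/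
def Space (_D : LocalLieData 𝕜 E P K) := K

instance : Group D.Space := inferInstanceAs (Group K)

/-- The bijection from `P` onto the Lie group. -/
def spaceEquiv : P ≃ D.Space := D.equiv

/-- The coordinates centered at `k`, with values in `P`. -/
def coord (k y : D.Space) : P := D.spaceEquiv.symm (k⁻¹ * y)

/-- The parametrization centered at `k`. -/
def param (k : D.Space) (p : P) : D.Space := k * D.spaceEquiv p

theorem coord_self (k : D.Space) : D.coord k k = D.equiv.symm 1 := by
  rw [coord, inv_mul_cancel]
  rfl

theorem param_mul_coord (a k y : D.Space) : D.param (a * k) (D.coord k y) = a * y := by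
  rw [param, coord, Equiv.apply_symm_apply, mul_assoc, mul_inv_cancel_left]

theorem param_one_coord_one (y : D.Space) : D.param 1 (D.coord 1 y) = y := by
  simpa using D.param_mul_coord 1 1 y

/-- The chart `e` of `P`, restricted to `nhd` and translated by `k`. -/
def chart (k : K) (e : OpenPartialHomeomorph P E) : PartialEquiv K E where
  toFun y := e (D.equiv.symm (k⁻¹ * y))
  invFun u := k * D.equiv (e.symm u)
  source := {y | D.equiv.symm (k⁻¹ * y) ∈ D.nhd ∩ e.source}
  target := e.target ∩ e.symm ⁻¹' D.nhd
  map_source' y hy := ⟨e.map_source hy.2, by simpa [e.left_inv hy.2] using hy.1⟩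
  map_target' u hu := by
    simpa using (⟨hu.2, e.map_target hu.1⟩ : e.symm u ∈ D.nhd ∩ e.source)
  left_inv' y hy := by simp [e.left_inv hy.2]
  right_inv' u hu := by simp [e.right_inv hu.1]

theorem chart_symm_trans_source (k k' : K) (e e' : OpenPartialHomeomorph P E) :
    ((D.chart k e).symm.trans (D.chart k' e')).source =
      e.target ∩ e.symm ⁻¹' ((D.nhd ∩ {p | D.equiv.symm (k'⁻¹ * k * D.equiv p) ∈ D.nhd}) ∩
        (fun p => D.equiv.symm (k'⁻¹ * k * D.equiv p)) ⁻¹' e'.source) := by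
  ext u
  simp [chart, PartialEquiv.trans_source, mul_assoc, and_assoc]

theorem isOpen_left (k : K) : IsOpen (D.nhd ∩ {p | D.equiv.symm (k * D.equiv p) ∈ D.nhd}) :=
  isOpen_iff_mem_nhds.2 fun p hp => inter_mem (D.isOpen_nhd.mem_nhds hp.1)
    ((D.smooth_left k p hp.1 hp.2).continuousAt.preimage_mem_nhds (D.isOpen_nhd.mem_nhds hp.2))

variable [PolynormableSpace 𝕜 E] [T2Space E]

theorem manSmoothOn_left (k : K) : ManSmoothOn 𝕜 E E (fun p => D.equiv.symm (k * D.equiv p))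
    (D.nhd ∩ {p | D.equiv.symm (k * D.equiv p) ∈ D.nhd}) :=
  .of_forall_manSmoothAt fun p hp => D.smooth_left k p hp.1 hp.2

theorem mbSmoothOn_chart_symm_trans (k k' : K) {e e' : OpenPartialHomeomorph P E}
    (he : e ∈ atlas E P) (he' : e' ∈ atlas E P) :
    MBSmoothOn 𝕜 ((D.chart k e).symm.trans (D.chart k' e'))
      ((D.chart k e).symm.trans (D.chart k' e')).source := by
  rw [chart_symm_trans_source]
  have h := (D.manSmoothOn_left (k'⁻¹ * k)).2 e he e' he'
  simp only [mul_assoc] at h ⊢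
  exact h

/-- The atlas of all left translates of the charts of `P`. -/
def core : ChartedSpaceCore E K where
  atlas := {c | ∃ k : K, ∃ e ∈ atlas E P, c = D.chart k e}
  chartAt y := D.chart y (chartAt E (D.equiv.symm 1))
  mem_chart_source y := by
    simpa [chart] using D.one_mem
  chart_mem_atlas y := ⟨y, _, chart_mem_atlas E _, rfl⟩
  open_source := by
    rintro _ _ ⟨k, e, -, rfl⟩ ⟨k', e', -, rfl⟩
    rw [chart_symm_trans_source]
    exact isOpen_target_inter_symm_preimage (D.manSmoothOn_left _).1 (D.isOpen_left _) e e'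
  continuousOn_toFun := by
    rintro _ _ ⟨k, e, he, rfl⟩ ⟨k', e', he', rfl⟩
    exact (D.mbSmoothOn_chart_symm_trans k k' he he').continuousOn

instance : TopologicalSpace D.Space := D.core.toTopologicalSpace

instance : ChartedSpace E D.Space := D.core.toChartedSpace

theorem chart_mem_core_atlas (k : K) {e : OpenPartialHomeomorph P E} (he : e ∈ atlas E P) :
    D.chart k e ∈ D.core.atlas := ⟨k, e, he, rfl⟩

/-- `LocalLieData.chart` as a chart of the manifold `D.Space`. -/
def homeo (k : K) {e : OpenPartialHomeomorph P E} (he : e ∈ atlas E P) :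
    OpenPartialHomeomorph D.Space E :=
  D.core.openPartialHomeomorph _ (D.chart_mem_core_atlas k he)

theorem mem_atlas_iff {c : OpenPartialHomeomorph D.Space E} :
    c ∈ atlas E D.Space ↔ ∃ (k : K) (e : OpenPartialHomeomorph P E) (he : e ∈ atlas E P),
      c = D.homeo k he := by
  change c ∈ ⋃ (e : PartialEquiv K E) (he : e ∈ D.core.atlas), {_} ↔ _
  simp only [mem_iUnion]
  constructor
  · rintro ⟨_, ⟨k, e, he, rfl⟩, rfl⟩
    exact ⟨k, e, he, rfl⟩
  · rintro ⟨k, e, he, rfl⟩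
    exact ⟨_, D.chart_mem_core_atlas k he, rfl⟩

instance : MBManifold 𝕜 E D.Space where
  isManifold := by
    intro c hc c' hc'
    obtain ⟨k, e, he, rfl⟩ := D.mem_atlas_iff.1 hc
    obtain ⟨k', e', he', rfl⟩ := D.mem_atlas_iff.1 hc'
    exact D.mbSmoothOn_chart_symm_trans k k' he he'

theorem isOpen_coord_preimage_nhd (k : D.Space) : IsOpen (D.coord k ⁻¹' D.nhd) := by
  have hcover : D.coord k ⁻¹' D.nhd =
      ⋃ (e : OpenPartialHomeomorph P E) (he : e ∈ atlas E P), (D.homeo k he).source := by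
    ext y
    simp only [mem_iUnion]
    exact ⟨fun hy => ⟨chartAt E (D.coord k y), chart_mem_atlas E _, hy, mem_chart_source E _⟩,
      fun ⟨_, _, hy⟩ => hy.1⟩
  rw [hcover]
  exact isOpen_iUnion fun e => isOpen_iUnion fun he => (D.homeo k he).open_source

theorem continuousOn_coord (k : D.Space) : ContinuousOn (D.coord k) (D.coord k ⁻¹' D.nhd) := by
  intro y hy
  have he := chart_mem_atlas E (D.coord k y)
  have hys : y ∈ (D.homeo k he).source := ⟨hy, mem_chart_source E _⟩
  have hcont : ContinuousAt (fun z => (chartAt E (D.coord k y)).symm (D.homeo k he z)) y :=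
    ContinuousAt.comp
      ((chartAt E (D.coord k y)).continuousAt_symm ((D.homeo k he).map_source hys).1)
      ((D.homeo k he).continuousAt hys)
  refine (hcont.congr ?_).continuousWithinAt
  filter_upwards [(D.homeo k he).open_source.mem_nhds hys] with z hz
  exact (chartAt E (D.coord k y)).left_inv hz.2

theorem manSmoothOn_coord (k : D.Space) :
    ManSmoothOn 𝕜 E E (D.coord k) (D.coord k ⁻¹' D.nhd) := by
  refine ⟨D.continuousOn_coord k, fun c hc e' he' => ?_⟩
  obtain ⟨k', e, he, rfl⟩ := D.mem_atlas_iff.1 hc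
  refine MBSmoothOn.mono (D.mbSmoothOn_chart_symm_trans k' k he he') fun x hx => ?_
  rw [PartialEquiv.trans_source]
  exact ⟨hx.1, hx.2⟩

theorem continuousOn_param (k : D.Space) : ContinuousOn (D.param k) D.nhd := by
  intro p hp
  have he := chart_mem_atlas E p
  have hpe := mem_chart_source E p
  have hcont : ContinuousAt (fun z => (D.homeo k he).symm (chartAt E p z)) p := by
    refine ContinuousAt.comp ((D.homeo k he).continuousAt_symm
      ⟨(chartAt E p).map_source hpe, ?_⟩) ((chartAt E p).continuousAt hpe)
    simpa only [mem_preimage, (chartAt E p).left_inv hpe] using hp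
  refine (hcont.congr ?_).continuousWithinAt
  filter_upwards [(chartAt E p).open_source.mem_nhds hpe] with z hz
  exact congrArg (D.param k) ((chartAt E p).left_inv hz)

theorem manSmoothOn_param (k : D.Space) : ManSmoothOn 𝕜 E E (D.param k) D.nhd := by
  refine ⟨D.continuousOn_param k, fun e he c hc => ?_⟩
  obtain ⟨k', e', he', rfl⟩ := D.mem_atlas_iff.1 hc
  refine MBSmoothOn.mono (D.mbSmoothOn_chart_symm_trans k k' he he') fun x hx => ?_
  rw [PartialEquiv.trans_source]
  exact ⟨⟨hx.1, hx.2.1⟩, hx.2.2⟩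

theorem manSmoothAt_coord_self (k : D.Space) : ManSmoothAt 𝕜 E E (D.coord k) k :=
  (D.manSmoothOn_coord k).manSmoothAt (D.isOpen_coord_preimage_nhd k) (by
    simpa only [mem_preimage, coord_self] using D.one_mem)

theorem manSmoothAt_param_equiv_symm_one (k : D.Space) :
    ManSmoothAt 𝕜 E E (D.param k) (D.equiv.symm 1) :=
  (D.manSmoothOn_param k).manSmoothAt D.isOpen_nhd D.one_mem

theorem manSmoothAt_mul_left (a y : D.Space) : ManSmoothAt 𝕜 E E (fun z => a * z) y := by
  simpa only [param_mul_coord] using (D.manSmoothAt_param_equiv_symm_one (a * y)).comp_of_eq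
    (D.manSmoothAt_coord_self y) (D.coord_self y)

theorem manSmoothAt_one_of_coord {F : D.Space → D.Space} (hF1 : F 1 = 1)
    (hF : ManSmoothAt 𝕜 E E (fun p => D.coord 1 (F (D.param 1 p))) (D.equiv.symm 1)) :
    ManSmoothAt 𝕜 E E F 1 := by
  have hcoord : ManSmoothAt 𝕜 E E (fun z => D.coord 1 (F z)) 1 := by
    simpa only [param_one_coord_one] using
      hF.comp_of_eq (D.manSmoothAt_coord_self 1) (D.coord_self 1)
  simpa only [param_one_coord_one] using (D.manSmoothAt_param_equiv_symm_one 1).comp_of_eq hcoord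
    (by rw [hF1, coord_self])

theorem manSmoothAt_inv_one : ManSmoothAt 𝕜 E E (fun z : D.Space => z⁻¹) 1 := by
  refine D.manSmoothAt_one_of_coord inv_one ?_
  simp only [coord, param, inv_one, one_mul]
  exact D.smooth_inv

theorem manSmoothAt_conj_one (k : D.Space) :
    ManSmoothAt 𝕜 E E (fun z : D.Space => k * z * k⁻¹) 1 := by
  refine D.manSmoothAt_one_of_coord (by simp) ?_
  simp only [coord, param, inv_one, one_mul]
  exact D.smooth_conj k

theorem manSmoothAt_mul_one_one :
    ManSmoothAt 𝕜 (E × E) E (fun z : D.Space × D.Space => z.1 * z.2)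
      ((1, 1) : D.Space × D.Space) := by
  have hid := manSmoothAt_id (𝕜 := 𝕜) (E := E × E) ((1, 1) : D.Space × D.Space)
  have hcoord : ManSmoothAt 𝕜 (E × E) E (fun z : D.Space × D.Space =>
      D.equiv.symm (D.equiv (D.coord 1 z.1) * D.equiv (D.coord 1 z.2))) (1, 1) :=
    D.smooth_mul.comp_of_eq
      (((D.manSmoothAt_coord_self 1).comp_of_eq hid.fst rfl).prodMk
        ((D.manSmoothAt_coord_self 1).comp_of_eq hid.snd rfl)) (by simp only [coord_self])
  refine ((D.manSmoothAt_param_equiv_symm_one 1).comp_of_eq hcoord ?_).congr_of_eventuallyEq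
    (.of_forall fun z => ?_)
  · simp [coord_self]
  · have hcoord_one : ∀ y : D.Space, D.equiv (D.coord 1 y) = y := fun y => by
      rw [coord, inv_one, one_mul]
      exact D.equiv.apply_symm_apply y
    simp only [param, one_mul, hcoord_one]
    exact (D.equiv.apply_symm_apply _).symm

/-- Near `(a, b)` one has `xy = ab · ((b⁻¹(a⁻¹x)b) · (b⁻¹y))`, which reduces smoothness of the
multiplication to smoothness at the identity. -/
theorem manSmoothAt_mul (a b : D.Space) :
    ManSmoothAt 𝕜 (E × E) E (fun z : D.Space × D.Space => z.1 * z.2) (a, b) := by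
  have hid := manSmoothAt_id (𝕜 := 𝕜) (E := E × E) (a, b)
  have hfst : ManSmoothAt 𝕜 (E × E) E (fun z : D.Space × D.Space => a⁻¹ * z.1) (a, b) :=
    (D.manSmoothAt_mul_left a⁻¹ a).comp_of_eq hid.fst rfl
  have hconj : ManSmoothAt 𝕜 (E × E) E
      (fun z : D.Space × D.Space => b⁻¹ * (a⁻¹ * z.1) * b⁻¹⁻¹) (a, b) :=
    (D.manSmoothAt_conj_one b⁻¹).comp_of_eq hfst (inv_mul_cancel a)
  have hsnd : ManSmoothAt 𝕜 (E × E) E (fun z : D.Space × D.Space => b⁻¹ * z.2) (a, b) :=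
    (D.manSmoothAt_mul_left b⁻¹ b).comp_of_eq hid.snd rfl
  have hmul := D.manSmoothAt_mul_one_one.comp_of_eq (hconj.prodMk hsnd) (by simp)
  simpa [mul_assoc] using (D.manSmoothAt_mul_left (a * b) _).comp_of_eq hmul rfl

theorem manSmoothAt_inv (a : D.Space) : ManSmoothAt 𝕜 E E (fun z : D.Space => z⁻¹) a := by
  have hinv : ManSmoothAt 𝕜 E E (fun z => (a⁻¹ * z)⁻¹) a :=
    D.manSmoothAt_inv_one.comp_of_eq (D.manSmoothAt_mul_left a⁻¹ a) (inv_mul_cancel a)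
  have hconj : ManSmoothAt 𝕜 E E (fun z => a * (a⁻¹ * z)⁻¹ * a⁻¹) a :=
    (D.manSmoothAt_conj_one a).comp_of_eq hinv (by simp)
  simpa [mul_assoc] using (D.manSmoothAt_mul_left a⁻¹ _).comp_of_eq hconj rfl

instance : IsMBLieGroup 𝕜 E D.Space where
  isManifold := MBManifold.isManifold
  smooth_mul := .of_forall_manSmoothAt fun z _ => D.manSmoothAt_mul z.1 z.2
  smooth_inv := .of_forall_manSmoothAt fun z _ => D.manSmoothAt_inv z

theorem isDiffeoOn_spaceEquiv :
    IsDiffeoOn 𝕜 E E D.spaceEquiv D.nhd (D.spaceEquiv.symm ⁻¹' D.nhd) := by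
  have hparam : D.param 1 = D.spaceEquiv := funext fun p => one_mul (D.spaceEquiv p)
  have hcoord : D.coord 1 = D.spaceEquiv.symm := funext fun y => by rw [coord, inv_one, one_mul]
  rw [← hcoord]
  refine ⟨D.isOpen_nhd, D.isOpen_coord_preimage_nhd 1, D.spaceEquiv.bijOn fun p => ?_,
    hparam ▸ D.manSmoothOn_param 1, D.coord 1, ⟨fun p _ => ?_, fun y _ => ?_⟩,
    D.manSmoothOn_coord 1⟩
  all_goals simp [hcoord]

end LocalLieData

/-! ### The action of locally smooth maps on smooth factor systems -/

section Act

variable {G : Type u} {N : Type v} [Group N]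

theorem actS_one (S : G → MulAut N) : actS 1 S = S := by
  funext g
  simp [actS]

theorem actS_mul (h h' : G → N) (S : G → MulAut N) :
    actS (h * h') S = actS h (actS h' S) := by
  funext g
  simp [actS, mul_assoc]

variable [Group G]

theorem actOmega_one (S : G → MulAut N) (ω : G → G → N) : actOmega 1 S ω = ω := by
  funext g g'
  simp [actOmega]

theorem actOmega_mul (h h' : G → N) (S : G → MulAut N) (ω : G → G → N) :
    actOmega (h * h') S ω = actOmega h (actS h' S) (actOmega h' S ω) := by
  funext g g'
  simp [actOmega, actS, mul_assoc]

theorem actOmega_mul_inv_conj (h : G → N) (S : G → MulAut N) (ω : G → G → N) (g x : G) :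
    actOmega h S ω g x * (actOmega h S ω (g * x * g⁻¹) g)⁻¹ =
      h g * S g (h x) * (ω g x * (ω (g * x * g⁻¹) g)⁻¹) * S (g * x * g⁻¹) (h g)⁻¹ *
        (h (g * x * g⁻¹))⁻¹ := by
  simp [actOmega, mul_assoc]

theorem actS_mul_actS {S : G → MulAut N} {ω : G → G → N}
    (hSω : ∀ g g' n, S g (S g' n) = ω g g' * S (g * g') n * (ω g g')⁻¹)
    (h : G → N) (g g' : G) :
    actS h S g * actS h S g' = MulAut.conj (actOmega h S ω g g') * actS h S (g * g') := by
  ext n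
  simp [actS, actOmega, hSω, mul_assoc]

theorem actS_actOmega_mul {S : G → MulAut N} {ω : G → G → N}
    (hSω : ∀ g g' n, S g (S g' n) = ω g g' * S (g * g') n * (ω g g')⁻¹)
    (hω : ∀ g g' g'', S g (ω g' g'') * ω g (g' * g'') = ω g g' * ω (g * g') g'')
    (h : G → N) (g g' g'' : G) :
    actS h S g (actOmega h S ω g' g'') * actOmega h S ω g (g' * g'') =
      actOmega h S ω g g' * actOmega h S ω (g * g') g'' := by
  simp [actS, actOmega, hSω, eq_mul_inv_of_mul_eq (hω g g' g''), mul_assoc]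

end Act

section Cochains

variable {𝕜 : Type w} [RCLike 𝕜]
  {EG : Type w₁} [AddCommGroup EG] [Module 𝕜 EG] [TopologicalSpace EG]
  {EN : Type w₂} [AddCommGroup EN] [Module 𝕜 EN] [TopologicalSpace EN]
  {G : Type u} [Group G] [TopologicalSpace G] [ChartedSpace EG G]
  {N : Type v} [Group N] [TopologicalSpace N] [ChartedSpace EN N]
  {h : G → N} {S : G → MulAut N} {ω : G → G → N}

theorem IsC1sAut.manSmoothAt_apply (hS : IsC1sAut 𝕜 EG EN S) (g : G) (n : N) :
    ManSmoothAt 𝕜 EN EN (S g) n :=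
  (hS.1 g).1.manSmoothAt_of_univ n

namespace SmoothFactorSystem

variable (f : SmoothFactorSystem 𝕜 EG EN G N)

theorem S_one : f.S 1 = 1 := f.isC1sAut.2.1

theorem ω_one_right (g : G) : f.ω g 1 = 1 := (f.isC2ss.1.2 g).1

theorem ω_one_left (g : G) : f.ω 1 g = 1 := (f.isC2ss.1.2 g).2

end SmoothFactorSystem

variable [PolynormableSpace 𝕜 EN] [T2Space EN]

theorem isC1sAut_of_manSmoothAt [PolynormableSpace 𝕜 EG] (hLie : ∀ g, IsLieAut 𝕜 EN (S g))
    (hS1 : S 1 = 1) {U : Set G} (hU : IsOpen U) (h1U : 1 ∈ U)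
    (hS : ∀ g ∈ U, ∀ n, ManSmoothAt 𝕜 (EG × EN) EN (fun p : G × N => S p.1 p.2) (g, n)) :
    IsC1sAut 𝕜 EG EN S :=
  ⟨hLie, hS1, U, hU, h1U, .of_forall_manSmoothAt fun p hp => hS p.1 hp.1 p.2⟩

section Comp

variable [PolynormableSpace 𝕜 EG]
  {E : Type w₃} [AddCommGroup E] [Module 𝕜 E] [TopologicalSpace E] [PolynormableSpace 𝕜 E]
  {M : Type v₁} [TopologicalSpace M] [ChartedSpace E M] {a a' : M → G} {b : M → N} {x : M}

theorem IsC1s.manSmoothAt_comp (hh : IsC1s 𝕜 EG EN h) (ha : ManSmoothAt 𝕜 E EG a x)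
    (hax : a x = 1) : ManSmoothAt 𝕜 E EN (fun y => h (a y)) x :=
  ManSmoothAt.comp_of_eq hh.1 ha hax

theorem IsC1sAut.manSmoothAt_comp (hS : IsC1sAut 𝕜 EG EN S) (ha : ManSmoothAt 𝕜 E EG a x)
    (hax : a x = 1) (hb : ManSmoothAt 𝕜 E EN b x) :
    ManSmoothAt 𝕜 E EN (fun y => S (a y) (b y)) x :=
  let ⟨_, hU, h1U, hSU⟩ := hS.2.2
  (hSU.manSmoothAt (x := (1, b x)) (hU.prod isOpen_univ) ⟨h1U, mem_univ _⟩).comp_of_eq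
    (ha.prodMk hb) (by rw [hax])

theorem IsC2s.manSmoothAt_comp (hω : IsC2s 𝕜 EG EN ω) (ha : ManSmoothAt 𝕜 E EG a x)
    (hax : a x = 1) (ha' : ManSmoothAt 𝕜 E EG a' x) (hax' : a' x = 1) :
    ManSmoothAt 𝕜 E EN (fun y => ω (a y) (a' y)) x :=
  ManSmoothAt.comp_of_eq hω.1 (ha.prodMk ha') (by rw [hax, hax']; rfl)

end Comp

variable [IsMBLieGroup 𝕜 EN N]

theorem isLieAut_conj_mul (n : N) {φ : MulAut N} (hφ : IsLieAut 𝕜 EN φ) :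
    IsLieAut 𝕜 EN (MulAut.conj n * φ) := by
  refine ⟨.of_forall_manSmoothAt fun x _ => ?_, .of_forall_manSmoothAt fun x _ => ?_⟩
  · exact ((manSmoothAt_const n x).mul (hφ.1.manSmoothAt_of_univ x)).mul (manSmoothAt_const n⁻¹ x)
  · exact (hφ.2.manSmoothAt_of_univ (n⁻¹ * x * n)).comp_of_eq
      (((manSmoothAt_const n⁻¹ x).mul (manSmoothAt_id x)).mul (manSmoothAt_const n x)) rfl

variable [PolynormableSpace 𝕜 EG]

variable (𝕜 EG EN G N) in
/-- The group `C^1_s(G,N)`, with pointwise multiplication. -/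
def c1sSubgroup : Subgroup (G → N) where
  carrier := {h | IsC1s 𝕜 EG EN h}
  one_mem' := ⟨(manSmoothOn_const 1 univ).manSmoothAt_of_univ 1, rfl⟩
  mul_mem' ha hb := ⟨ManSmoothAt.mul ha.1 hb.1, by simp [ha.2, hb.2]⟩
  inv_mem' ha := ⟨ManSmoothAt.inv ha.1, by simp [ha.2]⟩

variable [T2Space EG] [IsMBLieGroup 𝕜 EG G]

theorem isC1sAut_actS (hh : IsC1s 𝕜 EG EN h) (hS : IsC1sAut 𝕜 EG EN S) :
    IsC1sAut 𝕜 EG EN (actS h S) := by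
  obtain ⟨U, hU, h1U, hSU⟩ := hS.2.2
  obtain ⟨V, hV, h1V, hhV⟩ := hh.1
  refine isC1sAut_of_manSmoothAt (fun g => isLieAut_conj_mul _ (hS.1 g))
    (by rw [actS, hh.2, hS.2.1, map_one, one_mul]) (hU.inter hV) ⟨h1U, h1V⟩ fun g hg n => ?_
  have hSat := hSU.manSmoothAt (hU.prod isOpen_univ) (x := (g, n)) ⟨hg.1, mem_univ n⟩
  have hhat := (hhV.manSmoothAt hV hg.2).comp_of_eq
    (manSmoothAt_id (𝕜 := 𝕜) (E := EG × EN) (g, n)).fst rfl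
  exact (hhat.mul hSat).mul hhat.inv

theorem isC2s_actOmega (hh : IsC1s 𝕜 EG EN h) (hS : IsC1sAut 𝕜 EG EN S)
    (hω : IsC2s 𝕜 EG EN ω) : IsC2s 𝕜 EG EN (actOmega h S ω) := by
  refine ⟨?_, fun g => ⟨?_, ?_⟩⟩
  · have hid := manSmoothAt_id (𝕜 := 𝕜) (E := EG × EG) ((1, 1) : G × G)
    have hfst := hh.manSmoothAt_comp hid.fst rfl
    have hsnd := hh.manSmoothAt_comp hid.snd rfl
    have hmul := hh.manSmoothAt_comp (hid.fst.mul hid.snd) (mul_one 1)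
    exact ((hfst.mul (hS.manSmoothAt_comp hid.fst rfl hsnd)).mul hω.1).mul hmul.inv
  · simp [actOmega, hh.2, (hω.2 g).1]
  · simp [actOmega, hh.2, (hω.2 g).2, hS.2.1]

theorem isC2ss_actOmega (hh : IsC1s 𝕜 EG EN h) (hS : IsC1sAut 𝕜 EG EN S)
    (hω : IsC2ss 𝕜 EG EN ω) : IsC2ss 𝕜 EG EN (actOmega h S ω) := by
  refine ⟨isC2s_actOmega hh hS hω.1, fun g => ?_⟩
  simp only [actOmega_mul_inv_conj]
  have hid := manSmoothAt_id (𝕜 := 𝕜) (E := EG) (1 : G)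
  have hconj : ManSmoothAt 𝕜 EG EG (fun x => g * x * g⁻¹) (1 : G) :=
    ((manSmoothAt_const _ _).mul hid).mul (manSmoothAt_const _ _)
  have hShx := (hS.manSmoothAt_apply g (h 1)).comp_of_eq hh.1 rfl
  have hShg := hS.manSmoothAt_comp hconj (by simp) (manSmoothAt_const (h g)⁻¹ 1)
  have hh' := hh.manSmoothAt_comp hconj (by simp)
  exact ((((manSmoothAt_const (h g) 1).mul hShx).mul (hω.2 g)).mul hShg).mul hh'.inv

namespace SmoothFactorSystem

instance : SMul (c1sSubgroup 𝕜 EG EN G N) (SmoothFactorSystem 𝕜 EG EN G N) where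
  smul h f :=
    { S := actS h f.S
      ω := actOmega h f.S f.ω
      isC1sAut := isC1sAut_actS h.2 f.isC1sAut
      isC2ss := isC2ss_actOmega h.2 f.isC1sAut f.isC2ss
      delta_eq := fun g g' => mul_inv_eq_of_eq_mul
        (actS_mul_actS (TwistedProduct.S_S f) h g g')
      d_eq_one := fun g g' g'' => by
        rw [mul_inv_eq_one, mul_inv_eq_iff_eq_mul]
        exact actS_actOmega_mul (TwistedProduct.S_S f) (TwistedProduct.S_omega f) h g g' g'' }

theorem smul_S (h : c1sSubgroup 𝕜 EG EN G N) (f : SmoothFactorSystem 𝕜 EG EN G N) :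
    (h • f).S = actS h f.S := rfl

theorem smul_ω (h : c1sSubgroup 𝕜 EG EN G N) (f : SmoothFactorSystem 𝕜 EG EN G N) :
    (h • f).ω = actOmega h f.S f.ω := rfl

instance : MulAction (c1sSubgroup 𝕜 EG EN G N) (SmoothFactorSystem 𝕜 EG EN G N) where
  one_smul f := SmoothFactorSystem.ext (actS_one f.S) (actOmega_one f.S f.ω)
  mul_smul h h' f :=
    SmoothFactorSystem.ext (actS_mul h h' f.S) (actOmega_mul h h' f.S f.ω)

end SmoothFactorSystem

end Cochains

/-! ### Extensions, retractions and sections -/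

section Extensions

variable (𝕜 : Type w) [RCLike 𝕜]
  (EG : Type w₁) [AddCommGroup EG] [Module 𝕜 EG] [TopologicalSpace EG]
  (EN : Type w₂) [AddCommGroup EN] [Module 𝕜 EN] [TopologicalSpace EN]
  (E : Type w₃) [AddCommGroup E] [Module 𝕜 E] [TopologicalSpace E]
  {G : Type u} [TopologicalSpace G] [ChartedSpace EG G]
  {N : Type v} [TopologicalSpace N] [ChartedSpace EN N]
  {Ghat : Type v₁} [TopologicalSpace Ghat] [ChartedSpace E Ghat]

/-- `r` is a left inverse of `ι` that is smooth near the image of `ι`. For the inclusion of a Lie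
group extension it is the `N`-component in a trivialization around the fiber over `1`. -/
structure IsSmoothRetraction (ι : N → Ghat) (r : Ghat → N) : Prop where
  leftInverse : Function.LeftInverse r ι
  manSmoothAt : ∀ n, ManSmoothAt 𝕜 E EN r (ι n)

/-- `σ` is a section of `q` with `σ 1 = 1` that is smooth near `1`. Neither `q` nor `σ` is assumed
to be smooth, or even continuous, elsewhere. -/
structure IsNormalizedSection [One G] [One Ghat] (q : Ghat → G) (σ : G → Ghat) : Prop where
  rightInverse : Function.RightInverse σ q
  map_one : σ 1 = 1
  manSmoothAt : ManSmoothAt 𝕜 EG E σ 1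

end Extensions

section Extensions

variable {G : Type u} [Group G] {N : Type v} [Group N] {Ghat : Type v₁} [Group Ghat]
  (S : GroupExtension N Ghat G) {r : Ghat → N}

theorem inl_apply_of_rightHom_eq_one (hr : Function.LeftInverse r S.inl) {y : Ghat}
    (hy : S.rightHom y = 1) : S.inl (r y) = y := by
  obtain ⟨n, rfl⟩ : y ∈ S.inl.range := S.range_inl_eq_ker_rightHom ▸ hy
  rw [hr]

theorem conjAct_apply (hr : Function.LeftInverse r S.inl) (x : Ghat) (n : N) :
    S.conjAct x n = r (x * S.inl n * x⁻¹) := by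
  rw [← S.inl_conjAct_comm, hr]

variable {𝕜 : Type w} [RCLike 𝕜]
  {EN : Type w₂} [AddCommGroup EN] [Module 𝕜 EN] [TopologicalSpace EN]
  {E : Type w₃} [AddCommGroup E] [Module 𝕜 E] [TopologicalSpace E]
  [TopologicalSpace N] [ChartedSpace EN N] [TopologicalSpace Ghat] [ChartedSpace E Ghat]
  [PolynormableSpace 𝕜 EN] [T2Space EN] [PolynormableSpace 𝕜 E] {S}

namespace IsSmoothRetraction

theorem manSmoothAt_comp {E' : Type w₄} [AddCommGroup E'] [Module 𝕜 E'] [TopologicalSpace E']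
    [PolynormableSpace 𝕜 E'] {M : Type v₂} [TopologicalSpace M] [ChartedSpace E' M]
    (hr : IsSmoothRetraction 𝕜 EN E S.inl r) {a : M → Ghat} {x : M}
    (ha : ManSmoothAt 𝕜 E' E a x) (hax : S.rightHom (a x) = 1) :
    ManSmoothAt 𝕜 E' EN (fun y => r (a y)) x :=
  (hr.manSmoothAt (r (a x))).comp_of_eq ha
    (inl_apply_of_rightHom_eq_one S hr.leftInverse hax).symm

variable [T2Space E] [IsMBLieGroup 𝕜 E Ghat]

theorem isLieAut_conjAct (hr : IsSmoothRetraction 𝕜 EN E S.inl r)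
    (hι : ManSmoothOn 𝕜 EN E S.inl univ) (x : Ghat) : IsLieAut 𝕜 EN (S.conjAct x) := by
  have hconj : ∀ x : Ghat, ManSmoothOn 𝕜 EN EN (S.conjAct x) univ := fun x =>
    .of_forall_manSmoothAt fun n _ => by
      rw [funext (conjAct_apply S hr.leftInverse x)]
      exact hr.manSmoothAt_comp (((manSmoothAt_const x n).mul (hι.manSmoothAt_of_univ n)).mul
        (manSmoothAt_const x⁻¹ n)) (by simp)
  refine ⟨hconj x, ?_⟩
  rw [show (S.conjAct x).symm = S.conjAct x⁻¹ from (map_inv S.conjAct x).symm]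
  exact hconj x⁻¹

end IsSmoothRetraction

variable [T2Space E] {EG : Type w₁} [AddCommGroup EG] [Module 𝕜 EG] [TopologicalSpace EG]
  [PolynormableSpace 𝕜 EG] [TopologicalSpace G] [ChartedSpace EG G] {σ : G → Ghat}

theorem IsNormalizedSection.manSmoothAt_comp {E' : Type w₄} [AddCommGroup E'] [Module 𝕜 E']
    [TopologicalSpace E'] [PolynormableSpace 𝕜 E'] {M : Type v₂} [TopologicalSpace M]
    [ChartedSpace E' M]
    {q : Ghat → G} (hσ : IsNormalizedSection 𝕜 EG E q σ) {a : M → G} {x : M}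
    (ha : ManSmoothAt 𝕜 E' EG a x) (hax : a x = 1) :
    ManSmoothAt 𝕜 E' E (fun y => σ (a y)) x :=
  hσ.manSmoothAt.comp_of_eq ha hax

namespace IsSmoothRetraction

variable [T2Space EG] [IsMBLieGroup 𝕜 E Ghat]

section Bundle

variable [IsMBLieGroup 𝕜 EN N]

theorem isDiffeoOn_section_mul_inl [MBManifold 𝕜 EG G]
    (hr : IsSmoothRetraction 𝕜 EN E S.inl r) (hι : ManSmoothOn 𝕜 EN E S.inl univ)
    (hq : ManSmoothOn 𝕜 E EG S.rightHom univ) {U : Set G} (hU : IsOpen U)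
    (hσ : ∀ x ∈ U, S.rightHom (σ x) = x) (hσU : ManSmoothOn 𝕜 EG E σ U) :
    IsDiffeoOn 𝕜 (EG × EN) E (fun p : G × N => σ p.1 * S.inl p.2) (U ×ˢ univ)
      (S.rightHom ⁻¹' U) := by
  have hproj : ∀ p ∈ U ×ˢ (univ : Set N), S.rightHom (σ p.1 * S.inl p.2) = p.1 := fun p hp => by
    rw [map_mul, S.rightHom_inl, mul_one, hσ p.1 hp.1]
  have hker : ∀ y ∈ S.rightHom ⁻¹' U, S.rightHom ((σ (S.rightHom y))⁻¹ * y) = 1 := fun y hy => by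
    rw [map_mul, map_inv, hσ _ hy, inv_mul_cancel]
  have hinv : InvOn (fun y => (S.rightHom y, r ((σ (S.rightHom y))⁻¹ * y)))
      (fun p : G × N => σ p.1 * S.inl p.2) (U ×ˢ univ) (S.rightHom ⁻¹' U) := by
    refine ⟨fun p hp => ?_, fun y hy => ?_⟩
    · simp only [hproj p hp, inv_mul_cancel_left, hr.leftInverse p.2]
    · simp only [inl_apply_of_rightHom_eq_one S hr.leftInverse (hker y hy), mul_inv_cancel_left]
  refine ⟨hU.prod isOpen_univ, hU.preimage (continuousOn_univ.1 hq.1),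
    hinv.bijOn (fun p hp => ?_) (fun y hy => ⟨hy, mem_univ _⟩),
    .of_forall_manSmoothAt fun p hp => ?_, _, hinv, .of_forall_manSmoothAt fun y hy => ?_⟩
  · rw [mem_preimage, hproj p hp]
    exact hp.1
  · have hid := manSmoothAt_id (𝕜 := 𝕜) (E := EG × EN) p
    exact ((hσU.manSmoothAt hU hp.1).comp_of_eq hid.fst rfl).mul
      ((hι.manSmoothAt_of_univ p.2).comp_of_eq hid.snd rfl)
  · have hqy := hq.manSmoothAt_of_univ y
    have hσy := (hσU.manSmoothAt hU hy).comp_of_eq hqy rfl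
    exact hqy.prodMk (hr.manSmoothAt_comp (hσy.inv.mul (manSmoothAt_id y)) (hker y hy))

theorem isLieGroupExtension [IsMBLieGroup 𝕜 EG G] (hr : IsSmoothRetraction 𝕜 EN E S.inl r)
    (hσ : IsNormalizedSection 𝕜 EG E S.rightHom σ) (hι : ManSmoothOn 𝕜 EN E S.inl univ)
    (hq : ManSmoothOn 𝕜 E EG S.rightHom univ) :
    IsLieGroupExtension 𝕜 EG EN E S.inl S.rightHom where
  isLieGroup := inferInstance
  smooth_incl := hι
  smooth_proj := hq
  injective := S.inl_injective
  surjective := S.rightHom_surjective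
  exact := S.range_inl_eq_ker_rightHom
  locallyTrivial g := by
    have := IsMBLieGroup.isTopologicalGroup 𝕜 EG G
    obtain ⟨U, hU, h1U, hσU⟩ := hσ.manSmoothAt
    have hgU : IsOpen ((fun x => g⁻¹ * x) ⁻¹' U) := hU.preimage (continuous_const_mul g⁻¹)
    have hsection : ∀ x, S.rightHom (σ g * σ (g⁻¹ * x)) = x := fun x => by
      rw [map_mul, hσ.rightInverse, hσ.rightInverse, mul_inv_cancel_left]
    have hsmooth : ManSmoothOn 𝕜 EG E (fun x => σ g * σ (g⁻¹ * x)) ((fun x => g⁻¹ * x) ⁻¹' U) :=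
      .of_forall_manSmoothAt fun x hx => (manSmoothAt_const _ _).mul
        ((hσU.manSmoothAt hU hx).comp_of_eq ((manSmoothAt_const _ _).mul (manSmoothAt_id x)) rfl)
    exact ⟨_, hgU, by rwa [mem_preimage, inv_mul_cancel], _, hsmooth, fun x _ => hsection x,
      hr.isDiffeoOn_section_mul_inl hι hq hgU (fun x _ => hsection x) hsmooth⟩

end Bundle

/-! ### The factor system of a section -/

variable [IsMBLieGroup 𝕜 EG G]

theorem isC1sAut_conjAct [IsMBLieGroup 𝕜 EN N]
    (hr : IsSmoothRetraction 𝕜 EN E S.inl r) (hσ : IsNormalizedSection 𝕜 EG E S.rightHom σ)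
    (hι : ManSmoothOn 𝕜 EN E S.inl univ) : IsC1sAut 𝕜 EG EN fun g => S.conjAct (σ g) := by
  obtain ⟨U, hU, h1U, hσU⟩ := hσ.manSmoothAt
  refine isC1sAut_of_manSmoothAt (fun g => hr.isLieAut_conjAct hι (σ g))
    (by rw [hσ.map_one, map_one]) hU h1U fun g hg n => ?_
  simp only [conjAct_apply S hr.leftInverse]
  have hid := manSmoothAt_id (𝕜 := 𝕜) (E := EG × EN) (g, n)
  have hσg := (hσU.manSmoothAt hU hg).comp_of_eq hid.fst rfl
  have hιn := (hι.manSmoothAt_of_univ n).comp_of_eq hid.snd rfl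
  exact hr.manSmoothAt_comp ((hσg.mul hιn).mul hσg.inv) (by simp)

theorem isC2s_section (hr : IsSmoothRetraction 𝕜 EN E S.inl r)
    (hσ : IsNormalizedSection 𝕜 EG E S.rightHom σ) :
    IsC2s 𝕜 EG EN fun g g' => r (σ g * σ g' * (σ (g * g'))⁻¹) := by
  refine ⟨?_, fun g => ?_⟩
  · have hid := manSmoothAt_id (𝕜 := 𝕜) (E := EG × EG) ((1, 1) : G × G)
    have hfst := hσ.manSmoothAt_comp hid.fst rfl
    have hsnd := hσ.manSmoothAt_comp hid.snd rfl
    have hmul := hσ.manSmoothAt_comp (hid.fst.mul hid.snd) (mul_one 1)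
    exact hr.manSmoothAt_comp ((hfst.mul hsnd).mul hmul.inv) (by simp [hσ.map_one])
  · have hr1 : r 1 = 1 := by simpa only [map_one] using hr.leftInverse 1
    simp [hσ.map_one, hr1]

theorem isC2ss_section (hr : IsSmoothRetraction 𝕜 EN E S.inl r)
    (hσ : IsNormalizedSection 𝕜 EG E S.rightHom σ) :
    IsC2ss 𝕜 EG EN fun g g' => r (σ g * σ g' * (σ (g * g'))⁻¹) := by
  refine ⟨hr.isC2s_section hσ, fun g => ?_⟩
  have hσ' := hσ.rightInverse
  have hinl : ∀ y, S.rightHom y = 1 → S.inl (r y) = y := fun y =>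
    inl_apply_of_rightHom_eq_one S hr.leftInverse
  have hcocycle : ∀ x, r (σ g * σ x * (σ (g * x))⁻¹) *
      (r (σ (g * x * g⁻¹) * σ g * (σ (g * x * g⁻¹ * g))⁻¹))⁻¹ =
        r (σ g * σ x * (σ g)⁻¹ * (σ (g * x * g⁻¹))⁻¹) := fun x => S.inl_injective <| by
    rw [map_mul, map_inv, hinl _ (by simp [hσ' _]), hinl _ (by simp [hσ' _]),
      hinl _ (by simp [hσ' _]), inv_mul_cancel_right]
    group
  simp only [hcocycle]
  have hconj : ManSmoothAt 𝕜 EG EG (fun x => g * x * g⁻¹) (1 : G) :=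
    ((manSmoothAt_const _ _).mul (manSmoothAt_id _)).mul (manSmoothAt_const _ _)
  have hσconj := hσ.manSmoothAt_comp hconj (by simp)
  exact hr.manSmoothAt_comp ((((manSmoothAt_const (σ g) _).mul hσ.manSmoothAt).mul
    (manSmoothAt_const (σ g)⁻¹ _)).mul hσconj.inv) (by simp [hσ' _])

/-- The factor system `S(g) = C_{σ(g)}`, `ω(g,g') = σ(g) σ(g') σ(gg')⁻¹` of an extension with a
normalized section `σ`. Elements of the kernel are identified with elements of `N` by the
retraction `r`. -/
noncomputable def factorSystem [IsMBLieGroup 𝕜 EN N] (hr : IsSmoothRetraction 𝕜 EN E S.inl r)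
    (hσ : IsNormalizedSection 𝕜 EG E S.rightHom σ) (hι : ManSmoothOn 𝕜 EN E S.inl univ) :
    SmoothFactorSystem 𝕜 EG EN G N where
  S g := S.conjAct (σ g)
  ω g g' := r (σ g * σ g' * (σ (g * g'))⁻¹)
  isC1sAut := hr.isC1sAut_conjAct hσ hι
  isC2ss := hr.isC2ss_section hσ
  delta_eq g g' := by
    rw [mul_inv_eq_iff_eq_mul]
    ext n
    refine S.inl_injective ?_
    have hω := inl_apply_of_rightHom_eq_one S hr.leftInverse
      (y := σ g * σ g' * (σ (g * g'))⁻¹) (by simp [hσ.rightInverse _])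
    simp only [MulAut.mul_apply, MulAut.conj_apply, map_mul, map_inv, S.inl_conjAct_comm, hω]
    group
  d_eq_one g g' g'' := by
    have hω : ∀ g g', S.inl (r (σ g * σ g' * (σ (g * g'))⁻¹)) = σ g * σ g' * (σ (g * g'))⁻¹ :=
      fun g g' => inl_apply_of_rightHom_eq_one S hr.leftInverse (by simp [hσ.rightInverse _])
    refine S.inl_injective ?_
    simp only [map_mul, map_inv, S.inl_conjAct_comm, hω, map_one]
    group

end IsSmoothRetraction

end Extensions

/-! ### Equivalences of extensions -/

section Equivalences

variable {𝕜 : Type w} [RCLike 𝕜] {G : Type u} [Group G] {N : Type v} [Group N]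
  {E : Type w₃} [AddCommGroup E] [Module 𝕜 E] [TopologicalSpace E]
  {Ghat : Type v₁} [Group Ghat] [TopologicalSpace Ghat] [ChartedSpace E Ghat]

namespace IsExtEquivalence

theorem refl [IsMBLieGroup 𝕜 E Ghat] (ι : N →* Ghat) (q : Ghat →* G) :
    IsExtEquivalence 𝕜 E E ι q ι q (MonoidHom.id Ghat) where
  smooth := manSmoothOn_id univ
  comp_incl _ := rfl
  proj_comp _ := rfl

variable {ι : N →* Ghat} {q : Ghat →* G} [PolynormableSpace 𝕜 E]
  {E' : Type w₄} [AddCommGroup E'] [Module 𝕜 E'] [TopologicalSpace E'] [PolynormableSpace 𝕜 E']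
  {Ghat' : Type v₂} [Group Ghat'] [TopologicalSpace Ghat'] [ChartedSpace E' Ghat']
  {ι' : N →* Ghat'} {q' : Ghat' →* G}

theorem trans {E'' : Type*} [AddCommGroup E''] [Module 𝕜 E''] [TopologicalSpace E'']
    [PolynormableSpace 𝕜 E''] [T2Space E'']
    {Ghat'' : Type*} [Group Ghat''] [TopologicalSpace Ghat''] [ChartedSpace E'' Ghat'']
    {ι'' : N →* Ghat''} {q'' : Ghat'' →* G} {φ : Ghat →* Ghat'} {ψ : Ghat' →* Ghat''}
    (hφ : IsExtEquivalence 𝕜 E E' ι q ι' q' φ) (hψ : IsExtEquivalence 𝕜 E' E'' ι' q' ι'' q'' ψ) :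
    IsExtEquivalence 𝕜 E E'' ι q ι'' q'' (ψ.comp φ) where
  smooth := hψ.smooth.comp hφ.smooth isOpen_univ isOpen_univ (mapsTo_univ _ _)
  comp_incl n := by rw [MonoidHom.comp_apply, hφ.comp_incl, hψ.comp_incl]
  proj_comp x := by rw [MonoidHom.comp_apply, hψ.proj_comp, hφ.proj_comp]

end IsExtEquivalence

end Equivalences

section Extensions

variable {𝕜 : Type w} [RCLike 𝕜]
  {EG : Type w₁} [AddCommGroup EG] [Module 𝕜 EG] [TopologicalSpace EG]
  {EN : Type w₂} [AddCommGroup EN] [Module 𝕜 EN] [TopologicalSpace EN]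
  {G : Type u} [Group G] [TopologicalSpace G] [ChartedSpace EG G]
  {N : Type v} [Group N] [TopologicalSpace N] [ChartedSpace EN N]
  {E : Type w₃} [AddCommGroup E] [Module 𝕜 E] [TopologicalSpace E]
  {Ghat : Type v₁} [Group Ghat] [TopologicalSpace Ghat] [ChartedSpace E Ghat]
  {ι : N →* Ghat} {q : Ghat →* G}

namespace IsLieGroupExtension

/-- The short exact sequence of groups underlying an extension of Lie groups. -/
abbrev toGroupExtension (hX : IsLieGroupExtension 𝕜 EG EN E ι q) : GroupExtension N Ghat G where
  inl := ι
  rightHom := q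
  inl_injective := hX.injective
  range_inl_eq_ker_rightHom := hX.exact
  rightHom_surjective := hX.surjective

variable [PolynormableSpace 𝕜 EG] [PolynormableSpace 𝕜 E] [T2Space E]

theorem exists_isSmoothRetraction [T2Space EG] [PolynormableSpace 𝕜 EN] [T2Space EN]
    [IsMBLieGroup 𝕜 EN N] (hX : IsLieGroupExtension 𝕜 EG EN E ι q) :
    ∃ r : Ghat → N, IsSmoothRetraction 𝕜 EN E ι r := by
  have := hX.isLieGroup
  obtain ⟨U, -, h1U, σ, -, hσ, -, hqU, -, -, T, hT, hTU⟩ := hX.locallyTrivial 1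
  refine ⟨fun y => (T (σ 1 * y)).2, fun n => ?_, fun n => ?_⟩
  · rw [hT.1 (x := (1, n)) ⟨h1U, mem_univ n⟩]
  · have hmem : σ 1 * ι n ∈ q ⁻¹' U := by
      rwa [mem_preimage, map_mul, hσ 1 h1U, hX.toGroupExtension.rightHom_inl, mul_one]
    exact ((hTU.manSmoothAt hqU hmem).comp_of_eq
      ((manSmoothAt_const (σ 1) _).mul (manSmoothAt_id _)) rfl).snd

theorem exists_isNormalizedSection (hX : IsLieGroupExtension 𝕜 EG EN E ι q) :
    ∃ σ : G → Ghat, IsNormalizedSection 𝕜 EG E q σ := by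
  classical
  have := hX.isLieGroup
  obtain ⟨U, hU, h1U, σ, hσU, hσ, -⟩ := hX.locallyTrivial 1
  obtain ⟨τ, hτ⟩ := hX.surjective.hasRightInverse
  refine ⟨fun x => if x ∈ U then σ x * (σ 1)⁻¹ else τ x, fun x => ?_, by simp [h1U], ?_⟩
  · split_ifs with hx
    · rw [map_mul, map_inv, hσ x hx, hσ 1 h1U, inv_one, mul_one]
    · exact hτ x
  · refine ((hσU.manSmoothAt hU h1U).mul
      (manSmoothAt_const (σ 1)⁻¹ 1)).congr_of_eventuallyEq ?_
    filter_upwards [hU.mem_nhds h1U] with x hx using if_pos hx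

end IsLieGroupExtension

variable {E' : Type w₄} [AddCommGroup E'] [Module 𝕜 E'] [TopologicalSpace E']
  {Ghat' : Type v₂} [Group Ghat'] [TopologicalSpace Ghat'] [ChartedSpace E' Ghat']
  {ι' : N →* Ghat'} {q' : Ghat' →* G}
  [PolynormableSpace 𝕜 E] [T2Space E] [PolynormableSpace 𝕜 E']
  [PolynormableSpace 𝕜 EG] [PolynormableSpace 𝕜 EN] [T2Space EN]

theorem manSmoothOn_symm [T2Space E'] [IsMBLieGroup 𝕜 E Ghat]
    [IsMBLieGroup 𝕜 E' Ghat'] {S : GroupExtension N Ghat G} {S' : GroupExtension N Ghat' G}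
    (e : S.Equiv S') (he : ManSmoothOn 𝕜 E E' e univ) (hι : ManSmoothOn 𝕜 EN E S.inl univ)
    (hq' : ManSmoothOn 𝕜 E' EG S'.rightHom univ) {r : Ghat' → N}
    (hr : IsSmoothRetraction 𝕜 EN E' S'.inl r) {σ : G → Ghat}
    (hσ : IsNormalizedSection 𝕜 EG E S.rightHom σ) : ManSmoothOn 𝕜 E' E e.symm univ := by
  let a : Ghat' → Ghat := fun y => σ (S'.rightHom y)
  have hker : ∀ y, S'.rightHom ((e (a y))⁻¹ * y) = 1 := fun y => by
    rw [map_mul, map_inv, e.rightHom_map, hσ.rightInverse, inv_mul_cancel]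
  have hsymm : ∀ y, e.symm y = a y * S.inl (r ((e (a y))⁻¹ * y)) := fun y => by
    have hy : e (a y * S.inl (r ((e (a y))⁻¹ * y))) = y := by
      rw [map_mul, e.map_inl, inl_apply_of_rightHom_eq_one S' hr.leftInverse (hker y),
        mul_inv_cancel_left]
    exact (MulEquiv.symm_apply_eq (e : Ghat ≃* Ghat')).2 hy.symm
  refine manSmoothOn_univ_of_manSmoothAt_one (e.symm : Ghat' ≃* Ghat).toMonoidHom ?_
  have ha : ManSmoothAt 𝕜 E' E a 1 := hσ.manSmoothAt_comp (hq'.manSmoothAt_of_univ 1) (map_one _)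
  have hra := hr.manSmoothAt_comp (((he.manSmoothAt_of_univ (a 1)).comp_of_eq ha rfl).inv.mul
    (manSmoothAt_id 1)) (hker 1)
  exact (ha.mul ((hι.manSmoothAt_of_univ _).comp_of_eq hra rfl)).congr_of_eventuallyEq
    (.of_forall hsymm)

namespace IsExtEquivalence

theorem symm [T2Space EG] [T2Space E'] [IsMBLieGroup 𝕜 EN N] {φ : Ghat →* Ghat'}
    (hφ : IsExtEquivalence 𝕜 E E' ι q ι' q' φ) (hX : IsLieGroupExtension 𝕜 EG EN E ι q)
    (hY : IsLieGroupExtension 𝕜 EG EN E' ι' q') :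
    ∃ ψ : Ghat' →* Ghat, IsExtEquivalence 𝕜 E' E ι' q' ι q ψ := by
  have := hX.isLieGroup
  have := hY.isLieGroup
  obtain ⟨r, hr⟩ := hY.exists_isSmoothRetraction
  obtain ⟨σ, hσ⟩ := hX.exists_isNormalizedSection
  let e : hX.toGroupExtension.Equiv hY.toGroupExtension :=
    .ofMonoidHom φ (MonoidHom.ext hφ.comp_incl) (MonoidHom.ext hφ.proj_comp)
  exact ⟨(e.symm : Ghat' ≃* Ghat).toMonoidHom,
    manSmoothOn_symm e hφ.smooth hX.smooth_incl hY.smooth_proj hr hσ,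
    e.symm.map_inl, e.symm.rightHom_map⟩

end IsExtEquivalence

theorem LieExtension.equivalence_equivalent [T2Space EG] [IsMBLieGroup 𝕜 EN N] :
    Equivalence (LieExtension.Equivalent (𝕜 := 𝕜) (EG := EG) (EN := EN) (G := G) (N := N)) where
  refl X :=
    have := X.isExtension.isLieGroup
    ⟨_, .refl X.incl X.proj⟩
  symm := fun {X Y} ⟨_, hφ⟩ => hφ.symm X.isExtension Y.isExtension
  trans := fun ⟨_, hφ⟩ ⟨_, hψ⟩ => ⟨_, hφ.trans hψ⟩

end Extensions

/-! ### The Lie group structure of a twisted product -/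

section Twisted

variable {𝕜 : Type w} [RCLike 𝕜]
  {EG : Type w₁} [AddCommGroup EG] [Module 𝕜 EG] [TopologicalSpace EG]
  {EN : Type w₂} [AddCommGroup EN] [Module 𝕜 EN] [TopologicalSpace EN]
  {G : Type u} [Group G] [TopologicalSpace G] [ChartedSpace EG G]
  {N : Type v} [Group N] [TopologicalSpace N] [ChartedSpace EN N]

namespace TwistedProduct

variable (f : SmoothFactorSystem 𝕜 EG EN G N)

/-- The bijection `(n, g) ↦ (n, g)` from the product manifold `N × G` onto `N ×_f G`. -/
def equivProd : N × G ≃ TwistedProduct f where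
  toFun p := ⟨p.1, p.2⟩
  invFun x := (x.fst, x.snd)

theorem mul_mk_mul_inv (k : TwistedProduct f) (n : N) (x : G) :
    k * ⟨n, x⟩ * k⁻¹ = ⟨k.fst * (f.S k.snd n * (f.ω k.snd x *
      (f.ω (k.snd * x * k.snd⁻¹) k.snd)⁻¹)) * f.S (k.snd * x * k.snd⁻¹) k.fst⁻¹,
      k.snd * x * k.snd⁻¹⟩ := by
  rw [mul_inv_eq_iff_eq_mul]
  ext
  · simp [mul_def, mul_assoc]
  · simp [mul_def]

end TwistedProduct

namespace SmoothFactorSystem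

variable (f : SmoothFactorSystem 𝕜 EG EN G N)

/-- If `V` is so small that `ω` is smooth near `VV⁻¹ × V`, then it is smooth at `(g, x)`, because
`g = (gx)x⁻¹`. -/
theorem exists_manSmoothAt_ω_left [IsMBLieGroup 𝕜 EG G] : ∃ V : Set G, IsOpen V ∧ 1 ∈ V ∧
    ∀ g : G, ∀ x ∈ V, g * x ∈ V →
      ManSmoothAt 𝕜 (EG × EG) EN (fun p : G × G => f.ω p.1 p.2) (g, x) := by
  have := IsMBLieGroup.isTopologicalGroup 𝕜 EG G
  obtain ⟨W, hW, h1W, hωW⟩ := f.isC2ss.1.1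
  have hcont : Continuous fun p : G × G => (p.1 * p.2⁻¹, p.2) := by fun_prop
  have hnear : ∀ᶠ p : G × G in 𝓝 1, (p.1 * p.2⁻¹, p.2) ∈ W :=
    (hcont.tendsto' 1 (1, 1) (by simp)).eventually (hW.eventually_mem h1W)
  obtain ⟨V₁, hV₁, V₂, hV₂, hVW⟩ := mem_nhds_prod_iff.1 hnear
  obtain ⟨V, hV, hVo, h1V⟩ := mem_nhds_iff.1 (inter_mem hV₁ hV₂)
  refine ⟨V, hVo, h1V, fun g x hx hgx => hωW.manSmoothAt hW ?_⟩
  simpa using hVW (show (g * x, x) ∈ V₁ ×ˢ V₂ from ⟨(hV hgx).1, (hV hx).2⟩)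

variable [PolynormableSpace 𝕜 EG] [T2Space EG] [PolynormableSpace 𝕜 EN] [T2Space EN]
  [IsMBLieGroup 𝕜 EG G] [IsMBLieGroup 𝕜 EN N]

/-- The local Lie group data of `N ×_f G` on `N × V`, where `ω` is smooth as in
`exists_manSmoothAt_ω_left`. -/
def localLieData {V : Set G} (hV : IsOpen V) (h1V : 1 ∈ V)
    (hω : ∀ g : G, ∀ x ∈ V, g * x ∈ V →
      ManSmoothAt 𝕜 (EG × EG) EN (fun p : G × G => f.ω p.1 p.2) (g, x)) :
    LocalLieData 𝕜 (EN × EG) (N × G) (TwistedProduct f) where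
  equiv := TwistedProduct.equivProd f
  nhd := univ ×ˢ V
  isOpen_nhd := isOpen_univ.prod hV
  one_mem := ⟨mem_univ _, h1V⟩
  smooth_left k p hp hkp := by
    have hid := manSmoothAt_id (𝕜 := 𝕜) (E := EN × EG) p
    have hSp := (f.isC1sAut.manSmoothAt_apply k.snd p.1).comp_of_eq hid.fst rfl
    have hωp := (hω k.snd p.2 hp.2 hkp.2).comp_of_eq ((manSmoothAt_const k.snd p).prodMk hid.snd)
      rfl
    exact (((manSmoothAt_const k.fst p).mul hSp).mul hωp).prodMk
      ((manSmoothAt_const k.snd p).mul hid.snd)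
  smooth_mul := by
    have hid := manSmoothAt_id (𝕜 := 𝕜) (E := (EN × EG) × (EN × EG))
      (((1, 1), (1, 1)) : (N × G) × (N × G))
    exact ((hid.fst.fst.mul (f.isC1sAut.manSmoothAt_comp hid.fst.snd rfl hid.snd.fst)).mul
      (f.isC2ss.1.manSmoothAt_comp hid.fst.snd rfl hid.snd.snd rfl)).prodMk
      (hid.fst.snd.mul hid.snd.snd)
  smooth_inv := by
    have hid := manSmoothAt_id (𝕜 := 𝕜) (E := EN × EG) ((1, 1) : N × G)
    exact ((f.isC2ss.1.manSmoothAt_comp hid.snd.inv inv_one hid.snd rfl).inv.mul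
      (f.isC1sAut.manSmoothAt_comp hid.snd.inv inv_one hid.fst.inv)).prodMk hid.snd.inv
  smooth_conj k := by
    have hid := manSmoothAt_id (𝕜 := 𝕜) (E := EN × EG) ((1, 1) : N × G)
    have hconj : ManSmoothAt 𝕜 (EN × EG) EG (fun p : N × G => k.snd * p.2 * k.snd⁻¹) (1, 1) :=
      ((manSmoothAt_const _ _).mul hid.snd).mul (manSmoothAt_const _ _)
    have hS := (f.isC1sAut.manSmoothAt_apply k.snd 1).comp_of_eq hid.fst rfl
    have hωconj := ManSmoothAt.comp_of_eq (f.isC2ss.2 k.snd) hid.snd rfl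
    have hSconj := f.isC1sAut.manSmoothAt_comp hconj (by simp) (manSmoothAt_const k.fst⁻¹ _)
    exact ((((manSmoothAt_const k.fst _).mul (hS.mul hωconj)).mul hSconj).prodMk
      hconj).congr_of_eventuallyEq (.of_forall fun p =>
        congrArg (TwistedProduct.equivProd f).symm (TwistedProduct.mul_mk_mul_inv f k p.1 p.2))

theorem nonempty_twistedLieStructure : Nonempty (TwistedLieStructure f) := by
  obtain ⟨V, hV, h1V, hω⟩ := f.exists_manSmoothAt_ω_left
  let D := f.localLieData hV h1V hω
  have hpreimage : {x : TwistedProduct f | x.snd ∈ V} = D.spaceEquiv.symm ⁻¹' D.nhd :=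
    Set.ext fun x => ⟨fun hx => ⟨mem_univ _, hx⟩, fun hx => hx.2⟩
  exact ⟨{
    Model := EN × EG
    top := inferInstanceAs (TopologicalSpace D.Space)
    charted := inferInstanceAs (ChartedSpace (EN × EG) D.Space)
    isLieGroup := inferInstanceAs (IsMBLieGroup 𝕜 (EN × EG) D.Space)
    isDiffeoOn := ⟨V, hV, h1V, hpreimage ▸ D.isDiffeoOn_spaceEquiv⟩ }⟩

end SmoothFactorSystem

namespace TwistedLieStructure

variable {f : SmoothFactorSystem 𝕜 EG EN G N} (L : TwistedLieStructure f)

instance : IsMBLieGroup 𝕜 L.Model L.Carrier := L.isLieGroup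

/-- The component `n` of `(n, g)`, as a function on the Lie group. -/
def toN (x : L.Carrier) : N := TwistedProduct.fst x

/-- The short exact sequence of groups `N → N ×_f G → G`. -/
abbrev toGroupExtension : GroupExtension N L.Carrier G where
  inl := L.incl
  rightHom := L.proj
  inl_injective _ _ h := congrArg L.toN h
  range_inl_eq_ker_rightHom := by
    ext x
    exact ⟨fun ⟨_, hn⟩ => hn ▸ rfl, fun hx => ⟨L.toN x, TwistedProduct.ext rfl hx.symm⟩⟩
  rightHom_surjective g := ⟨L.mk' 1 g, rfl⟩

theorem manSmoothAt_mk' (n : N) :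
    ManSmoothAt 𝕜 (EN × EG) L.Model (fun p : N × G => L.mk' p.1 p.2) (n, 1) :=
  let ⟨_, _, h1U, hopen, _, _, hmk, _⟩ := L.isDiffeoOn
  ManSmoothOn.manSmoothAt (M' := L.Carrier) hmk hopen ⟨mem_univ n, h1U⟩

theorem manSmoothAt_toN_proj (n : N) :
    ManSmoothAt 𝕜 L.Model (EN × EG) (fun x => (L.toN x, L.proj x)) (L.incl n) := by
  obtain ⟨U, -, h1U, -, hopen, -, -, F, ⟨hF, -⟩, hFU⟩ := L.isDiffeoOn
  have hcoord : EqOn (fun x : L.Carrier => (L.toN x, L.proj x)) F {x | x.snd ∈ U} := fun x hx =>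
    (hF (x := (L.toN x, L.proj x)) ⟨mem_univ _, hx⟩).symm
  exact (ManSmoothOn.congr (M := L.Carrier) hFU hopen hcoord).manSmoothAt hopen h1U

variable [PolynormableSpace 𝕜 EG] [PolynormableSpace 𝕜 EN]

theorem manSmoothOn_of_manSmoothAt_mk' {E : Type w₃} [AddCommGroup E] [Module 𝕜 E]
    [TopologicalSpace E] [PolynormableSpace 𝕜 E] [T2Space E] {H : Type v₁} [Group H]
    [TopologicalSpace H] [ChartedSpace E H] [IsMBLieGroup 𝕜 E H] (φ : L.Carrier →* H)
    (hφ : ManSmoothAt 𝕜 (EN × EG) E (fun p : N × G => φ (L.mk' p.1 p.2)) (1, 1)) :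
    ManSmoothOn 𝕜 L.Model E φ univ :=
  manSmoothOn_univ_of_manSmoothAt_one φ (hφ.comp_of_eq (L.manSmoothAt_toN_proj 1) rfl)

theorem isDiffeoOn_id (L' : TwistedLieStructure f) : IsDiffeoOn 𝕜 L.Model L'.Model
    (fun x : L.Carrier => L'.mk' x.fst x.snd) univ univ :=
  let φ : L.Carrier →* L'.Carrier := MonoidHom.id (TwistedProduct f)
  let ψ : L'.Carrier →* L.Carrier := MonoidHom.id (TwistedProduct f)
  ⟨isOpen_univ, isOpen_univ, bijOn_univ.2 Function.bijective_id,
    L.manSmoothOn_of_manSmoothAt_mk' φ (L'.manSmoothAt_mk' 1), ψ,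
    ⟨fun _ _ => rfl, fun _ _ => rfl⟩, L'.manSmoothOn_of_manSmoothAt_mk' ψ (L.manSmoothAt_mk' 1)⟩

theorem isNormalizedSection_mk'_one [IsMBLieGroup 𝕜 EG G] :
    IsNormalizedSection 𝕜 EG L.Model L.proj (L.mk' 1) where
  rightInverse _ := rfl
  map_one := rfl
  manSmoothAt := (L.manSmoothAt_mk' 1).comp_of_eq
    ((manSmoothAt_const 1 1).prodMk (manSmoothAt_id 1)) rfl

variable [IsMBLieGroup 𝕜 EN N]

theorem manSmoothOn_incl : ManSmoothOn 𝕜 EN L.Model L.incl univ :=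
  .of_forall_manSmoothAt fun n _ => (L.manSmoothAt_mk' n).comp_of_eq
    ((manSmoothAt_id n).prodMk (manSmoothAt_const 1 n)) rfl

theorem manSmoothOn_proj [T2Space EG] [IsMBLieGroup 𝕜 EG G] :
    ManSmoothOn 𝕜 L.Model EG L.proj univ :=
  L.manSmoothOn_of_manSmoothAt_mk' L.proj
    (manSmoothAt_id (𝕜 := 𝕜) (E := EN × EG) ((1, 1) : N × G)).snd

variable [T2Space EN]

theorem isSmoothRetraction_toN : IsSmoothRetraction 𝕜 EN L.Model L.incl L.toN where
  leftInverse _ := rfl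
  manSmoothAt n := (L.manSmoothAt_toN_proj n).fst

theorem isExtension [T2Space EG] [IsMBLieGroup 𝕜 EG G] : L.IsExtension :=
  IsSmoothRetraction.isLieGroupExtension (S := L.toGroupExtension) L.isSmoothRetraction_toN
    L.isNormalizedSection_mk'_one L.manSmoothOn_incl L.manSmoothOn_proj

end TwistedLieStructure

end Twisted

/-! ### Equivalences of twisted products -/

section TwistedEquivalences

variable {𝕜 : Type w} [RCLike 𝕜]
  {EG : Type w₁} [AddCommGroup EG] [Module 𝕜 EG] [TopologicalSpace EG]
  {EN : Type w₂} [AddCommGroup EN] [Module 𝕜 EN] [TopologicalSpace EN]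
  {G : Type u} [Group G] [TopologicalSpace G] [ChartedSpace EG G]
  {N : Type v} [Group N] [TopologicalSpace N] [ChartedSpace EN N]

namespace TwistedProduct

variable {f f' : SmoothFactorSystem 𝕜 EG EN G N}

theorem incl_mul_mk_one (n : N) (g : G) :
    inclHom f n * (⟨1, g⟩ : TwistedProduct f) = ⟨n, g⟩ := by
  simp [inclHom, mul_def, f.ω_one_left]

theorem map_mk {φ : TwistedProduct f' →* TwistedProduct f}
    (hincl : ∀ n, φ (inclHom f' n) = inclHom f n)
    (hproj : ∀ x, projHom f (φ x) = projHom f' x) (n : N) (g : G) :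
    φ ⟨n, g⟩ = ⟨n * (φ ⟨1, g⟩).fst, g⟩ := by
  have hsnd : φ ⟨1, g⟩ = ⟨(φ ⟨1, g⟩).fst, g⟩ := TwistedProduct.ext rfl (hproj ⟨1, g⟩)
  rw [← incl_mul_mk_one n g, map_mul, hincl, hsnd]
  simp [inclHom, mul_def, f.S_one, f.ω_one_left]

variable {h : G → N} (φ : TwistedProduct f' →* TwistedProduct f)
  (hφ : ∀ n g, φ ⟨n, g⟩ = ⟨n * h g, g⟩)

include hφ

theorem S_eq_actS_of_map_mk : f'.S = actS h f.S := by
  have h1 : h 1 = 1 := by simpa [one_def] using (hφ 1 1).symm.trans (map_one φ)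
  ext g n
  have hmul := map_mul φ ⟨1, g⟩ ⟨n, 1⟩
  simp only [mul_def, hφ, one_mul, mul_one, f'.ω_one_right, f.ω_one_right, h1,
    TwistedProduct.mk.injEq, and_true] at hmul
  exact eq_mul_inv_of_mul_eq hmul

theorem ω_eq_actOmega_of_map_mk : f'.ω = actOmega h f.S f.ω := by
  ext g g'
  have hmul := map_mul φ ⟨1, g⟩ ⟨1, g'⟩
  simp only [mul_def, hφ, one_mul, map_one, TwistedProduct.mk.injEq, and_true] at hmul
  exact eq_mul_inv_of_mul_eq hmul

end TwistedProduct

variable [PolynormableSpace 𝕜 EG] [PolynormableSpace 𝕜 EN] [T2Space EN]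
  [IsMBLieGroup 𝕜 EG G] [IsMBLieGroup 𝕜 EN N]

theorem TwistedLieStructure.IsEquivalence.isC1s {f f' : SmoothFactorSystem 𝕜 EG EN G N}
    {L : TwistedLieStructure f} {L' : TwistedLieStructure f'} {φ : L'.Carrier →* L.Carrier}
    (hφ : L'.IsEquivalence L φ) : IsC1s 𝕜 EG EN fun g => L.toN (φ (L'.mk' 1 g)) := by
  have hφ1 : φ (L'.mk' 1 1) = L.incl 1 := hφ.comp_incl 1
  refine ⟨?_, congrArg L.toN hφ1⟩
  have hσ := (hφ.smooth.manSmoothAt_of_univ _).comp_of_eq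
    L'.isNormalizedSection_mk'_one.manSmoothAt rfl
  exact (L.isSmoothRetraction_toN.manSmoothAt 1).comp_of_eq hσ hφ1

variable [T2Space EG]

/-- The morphism `(n, g) ↦ (n h(g), g)` that identifies the twisted products of the factor systems
in an orbit. -/
def TwistedProduct.smulHom (h : c1sSubgroup 𝕜 EG EN G N) (f : SmoothFactorSystem 𝕜 EG EN G N) :
    TwistedProduct (h • f) →* TwistedProduct f where
  toFun x := ⟨x.fst * h.1 x.snd, x.snd⟩
  map_one' := by simp [one_def, h.2.2]
  map_mul' x y := by
    simp [mul_def, SmoothFactorSystem.smul_S, SmoothFactorSystem.smul_ω, actS, actOmega,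
      mul_assoc]

namespace TwistedLieStructure

variable {f f' : SmoothFactorSystem 𝕜 EG EN G N} (L : TwistedLieStructure f)
  (L' : TwistedLieStructure f')

theorem exists_isEquivalence_of_smul_eq {h : c1sSubgroup 𝕜 EG EN G N} (hf : h • f = f') :
    ∃ φ : L'.Carrier →* L.Carrier, L'.IsEquivalence L φ ∧
      ∀ (n : N) (g : G), φ (L'.mk' n g) = L.mk' (n * h.1 g) g := by
  subst hf
  let φ : L'.Carrier →* L.Carrier := TwistedProduct.smulHom h f
  have hincl (n : N) : φ (L'.incl n) = L.incl n := by
    change L.mk' (n * h.1 1) 1 = L.mk' n 1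
    rw [h.2.2, mul_one]
  refine ⟨φ, ⟨L'.manSmoothOn_of_manSmoothAt_mk' φ ?_, hincl, fun _ => rfl⟩, fun _ _ => rfl⟩
  have hid := manSmoothAt_id (𝕜 := 𝕜) (E := EN × EG) ((1, 1) : N × G)
  exact (L.manSmoothAt_mk' (1 * h.1 1)).comp_of_eq
    ((hid.fst.mul (h.2.manSmoothAt_comp hid.snd rfl)).prodMk hid.snd) rfl

variable {L L'}

theorem IsEquivalence.exists_smul_eq {φ : L'.Carrier →* L.Carrier}
    (hφ : L'.IsEquivalence L φ) :
    ∃ h : c1sSubgroup 𝕜 EG EN G N, h • f = f' ∧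
      ∀ (n : N) (g : G), φ (L'.mk' n g) = L.mk' (n * h.1 g) g := by
  let φ' : TwistedProduct f' →* TwistedProduct f := φ
  have hmk := TwistedProduct.map_mk (φ := φ') hφ.comp_incl hφ.proj_comp
  exact ⟨⟨_, hφ.isC1s⟩, SmoothFactorSystem.ext (TwistedProduct.S_eq_actS_of_map_mk φ' hmk).symm
    (TwistedProduct.ω_eq_actOmega_of_map_mk φ' hmk).symm, hmk⟩

theorem equivalent_toLieExtension_iff (hL : L.IsExtension) (hL' : L'.IsExtension) :
    LieExtension.Equivalent (L.toLieExtension hL) (L'.toLieExtension hL') ↔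
      ∃ h : c1sSubgroup 𝕜 EG EN G N, h • f = f' := by
  constructor
  · intro hLL'
    obtain ⟨φ, hφ⟩ := LieExtension.equivalence_equivalent.symm hLL'
    obtain ⟨h, hf, -⟩ := IsEquivalence.exists_smul_eq hφ
    exact ⟨h, hf⟩
  · rintro ⟨h, hf⟩
    obtain ⟨φ, hφ, -⟩ := exists_isEquivalence_of_smul_eq L L' hf
    exact LieExtension.equivalence_equivalent.symm ⟨φ, hφ⟩

end TwistedLieStructure

end TwistedEquivalences

/-! ### Classification of extensions -/

section Classification

variable {𝕜 : Type w} [RCLike 𝕜]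
  {EG : Type w₁} [AddCommGroup EG] [Module 𝕜 EG] [TopologicalSpace EG] [PolynormableSpace 𝕜 EG]
  [T2Space EG]
  {EN : Type w₂} [AddCommGroup EN] [Module 𝕜 EN] [TopologicalSpace EN] [PolynormableSpace 𝕜 EN]
  [T2Space EN]
  {G : Type u} [Group G] [TopologicalSpace G] [ChartedSpace EG G] [IsMBLieGroup 𝕜 EG G]
  {N : Type v} [Group N] [TopologicalSpace N] [ChartedSpace EN N] [IsMBLieGroup 𝕜 EN N]

section OfSection

variable {E : Type w₃} [AddCommGroup E] [Module 𝕜 E] [TopologicalSpace E] [PolynormableSpace 𝕜 E]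
  [T2Space E] {Ghat : Type v₁} [Group Ghat] [TopologicalSpace Ghat] [ChartedSpace E Ghat]
  [IsMBLieGroup 𝕜 E Ghat] {S : GroupExtension N Ghat G} {r : Ghat → N} {σ : G → Ghat}
  (hr : IsSmoothRetraction 𝕜 EN E S.inl r) (hσ : IsNormalizedSection 𝕜 EG E S.rightHom σ)
  (hι : ManSmoothOn 𝕜 EN E S.inl univ)

/-- The morphism `(n, g) ↦ ι(n) σ(g)` onto the extension from the twisted product of the factor
system of `σ`. -/
noncomputable def TwistedProduct.sectionHom : TwistedProduct (hr.factorSystem hσ hι) →* Ghat :=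
  MonoidHom.mk' (fun x => S.inl x.fst * σ x.snd) fun x y => by
    have hω := inl_apply_of_rightHom_eq_one S hr.leftInverse
      (y := σ x.snd * σ y.snd * (σ (x.snd * y.snd))⁻¹) (by simp [hσ.rightInverse _])
    change S.inl (x.fst * S.conjAct (σ x.snd) y.fst *
        r (σ x.snd * σ y.snd * (σ (x.snd * y.snd))⁻¹)) * σ (x.snd * y.snd) =
      S.inl x.fst * σ x.snd * (S.inl y.fst * σ y.snd)
    rw [map_mul, map_mul, S.inl_conjAct_comm, hω]
    group

theorem exists_isExtEquivalence (L : TwistedLieStructure (hr.factorSystem hσ hι)) :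
    ∃ φ : L.Carrier →* Ghat, IsExtEquivalence 𝕜 L.Model E L.incl L.proj S.inl S.rightHom φ := by
  let φ : L.Carrier →* Ghat := TwistedProduct.sectionHom hr hσ hι
  refine ⟨φ, L.manSmoothOn_of_manSmoothAt_mk' φ ?_, fun n => ?_, fun x => ?_⟩
  · have hid := manSmoothAt_id (𝕜 := 𝕜) (E := EN × EG) ((1, 1) : N × G)
    exact ((hι.manSmoothAt_of_univ 1).comp_of_eq hid.fst rfl).mul
      (hσ.manSmoothAt_comp hid.snd rfl)
  · change S.inl n * σ 1 = S.inl n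
    rw [hσ.map_one, mul_one]
  · change S.rightHom (S.inl (L.toN x) * σ (L.proj x)) = L.proj x
    rw [map_mul, S.rightHom_inl, one_mul, hσ.rightInverse]

end OfSection

theorem LieExtension.exists_equivalent_toLieExtension (X : LieExtension 𝕜 EG EN G N) :
    ∃ f : SmoothFactorSystem 𝕜 EG EN G N, ∀ (L : TwistedLieStructure f) (hL : L.IsExtension),
      LieExtension.Equivalent (L.toLieExtension hL) X := by
  have := X.isExtension.isLieGroup
  obtain ⟨r, hr⟩ := X.isExtension.exists_isSmoothRetraction
  obtain ⟨σ, hσ⟩ := X.isExtension.exists_isNormalizedSection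
  exact ⟨IsSmoothRetraction.factorSystem (S := X.isExtension.toGroupExtension) hr hσ
    X.isExtension.smooth_incl, fun L _ => exists_isExtEquivalence hr hσ _ L⟩

/-- The class in `Ext(G,N)` of the twisted products of the factor systems in an orbit of
`C^1_s(G,N)`. The Lie group structure on the twisted product is chosen arbitrarily, see
`orbitToLieExt_mk`. -/
noncomputable def orbitToLieExt :
    MulAction.orbitRel.Quotient (c1sSubgroup 𝕜 EG EN G N) (SmoothFactorSystem 𝕜 EG EN G N) →
      LieExt 𝕜 EG EN G N :=
  Quotient.lift (fun f =>
    Quot.mk _ (f.nonempty_twistedLieStructure.some.toLieExtension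
      (TwistedLieStructure.isExtension _))) <| by
    rintro f f' hff'
    exact Quot.sound (LieExtension.equivalence_equivalent.symm
      ((TwistedLieStructure.equivalent_toLieExtension_iff _ _).2 (MulAction.orbitRel_apply.1 hff')))

theorem orbitToLieExt_mk (f : SmoothFactorSystem 𝕜 EG EN G N) (L : TwistedLieStructure f)
    (hL : L.IsExtension) :
    orbitToLieExt (Quotient.mk _ f) = Quot.mk _ (L.toLieExtension hL) :=
  Quot.sound ((TwistedLieStructure.equivalent_toLieExtension_iff _ _).2 ⟨1, one_smul _ f⟩)

theorem orbitToLieExt_injective :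
    Function.Injective (orbitToLieExt (𝕜 := 𝕜) (EG := EG) (EN := EN) (G := G) (N := N)) := by
  refine fun x y => Quotient.inductionOn₂ x y fun f f' hff' => ?_
  obtain ⟨h, hf⟩ := (TwistedLieStructure.equivalent_toLieExtension_iff _ _).1
    (LieExtension.equivalence_equivalent.eqvGen_iff.1 (Quot.eqvGen_exact hff'))
  exact Quotient.sound (Setoid.symm' _ (MulAction.orbitRel_apply.2 ⟨h, hf⟩))

theorem orbitToLieExt_surjective :
    Function.Surjective (orbitToLieExt (𝕜 := 𝕜) (EG := EG) (EN := EN) (G := G) (N := N)) :=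
  Quot.ind fun X =>
    let ⟨f, hf⟩ := X.exists_equivalent_toLieExtension
    ⟨Quotient.mk _ f, Quot.sound (hf _ _)⟩

end Classification

theorem mainTheorem4 {𝕜 : Type w} [RCLike 𝕜]
    {EG : Type w₁} [AddCommGroup EG] [Module 𝕜 EG] [TopologicalSpace EG]
    [PolynormableSpace 𝕜 EG] [T2Space EG]
    {EN : Type w₂} [AddCommGroup EN] [Module 𝕜 EN] [TopologicalSpace EN]
    [PolynormableSpace 𝕜 EN] [T2Space EN]
    {G : Type u} [Group G] [TopologicalSpace G] [ChartedSpace EG G] [IsMBLieGroup 𝕜 EG G]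
    {N : Type v} [Group N] [TopologicalSpace N] [ChartedSpace EN N] [IsMBLieGroup 𝕜 EN N] :
    -- every `N ×_f G` carries a Lie group structure as described, it is unique,
    -- and it makes `N ×_f G` an extension of `G` by `N`
    (∀ f : SmoothFactorSystem 𝕜 EG EN G N, Nonempty (TwistedLieStructure f)) ∧
    (∀ (f : SmoothFactorSystem 𝕜 EG EN G N) (L L' : TwistedLieStructure f),
      IsDiffeoOn 𝕜 L.Model L'.Model (fun x : L.Carrier => L'.mk' x.fst x.snd) univ univ) ∧
    (∀ (f : SmoothFactorSystem 𝕜 EG EN G N) (L : TwistedLieStructure f), L.IsExtension) ∧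
    -- equivalence of extensions is an equivalence relation
    Equivalence (LieExtension.Equivalent (𝕜 := 𝕜) (EG := EG) (EN := EN) (G := G) (N := N)) ∧
    -- `C^1_s(G,N)` is a group under pointwise multiplication and acts on `Z^2_ss(G,N)`
    ∃ (C : Subgroup (G → N)) (_ : MulAction C (SmoothFactorSystem 𝕜 EG EN G N)),
      (∀ h : G → N, h ∈ C ↔ IsC1s 𝕜 EG EN h) ∧
      (∀ (h : C) (f : SmoothFactorSystem 𝕜 EG EN G N),
        (h • f).S = actS (h : G → N) f.S ∧ (h • f).ω = actOmega (h : G → N) f.S f.ω) ∧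
      -- equivalent extensions correspond to factor systems in the same orbit
      (∀ (f f' : SmoothFactorSystem 𝕜 EG EN G N)
        (L : TwistedLieStructure f) (L' : TwistedLieStructure f')
        (hL : L.IsExtension) (hL' : L'.IsExtension),
        (LieExtension.Equivalent (L.toLieExtension hL) (L'.toLieExtension hL') ↔
          ∃ h : C, h • f = f')) ∧
      -- the equivalences `N ×_f' G → N ×_f G` are the maps `(n, g) ↦ (n h(g), g)`
      (∀ (f f' : SmoothFactorSystem 𝕜 EG EN G N)
        (L : TwistedLieStructure f) (L' : TwistedLieStructure f'),
        (∀ h : C, h • f = f' → ∃ φ : L'.Carrier →* L.Carrier, L'.IsEquivalence L φ ∧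
          ∀ (n : N) (g : G), φ (L'.mk' n g) = L.mk' (n * (h : G → N) g) g) ∧
        (∀ φ : L'.Carrier →* L.Carrier, L'.IsEquivalence L φ →
          ∃ h : C, h • f = f' ∧
            ∀ (n : N) (g : G), φ (L'.mk' n g) = L.mk' (n * (h : G → N) g) g)) ∧
      -- `(S,ω) ↦ [N ×_(S,ω) G]` induces a bijection `Z^2_ss(G,N) / C^1_s(G,N) → Ext(G,N)`
      ∃ Φ : MulAction.orbitRel.Quotient C (SmoothFactorSystem 𝕜 EG EN G N) →
          LieExt 𝕜 EG EN G N,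
        Function.Bijective Φ ∧
        ∀ (f : SmoothFactorSystem 𝕜 EG EN G N) (L : TwistedLieStructure f) (hL : L.IsExtension),
          Φ (Quotient.mk _ f) = Quot.mk _ (L.toLieExtension hL) := by
  exact ⟨fun f => f.nonempty_twistedLieStructure, fun f L L' => L.isDiffeoOn_id L',
    fun f L => L.isExtension, LieExtension.equivalence_equivalent, c1sSubgroup 𝕜 EG EN G N,
    inferInstance, fun h => Iff.rfl,
    fun h f => ⟨SmoothFactorSystem.smul_S h f, SmoothFactorSystem.smul_ω h f⟩,
    fun f f' L L' hL hL' => TwistedLieStructure.equivalent_toLieExtension_iff hL hL',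
    fun f f' L L' => ⟨fun h hf => L.exists_isEquivalence_of_smul_eq L' hf,
      fun φ hφ => hφ.exists_smul_eq⟩,
    orbitToLieExt, ⟨orbitToLieExt_injective, orbitToLieExt_surjective⟩, orbitToLieExt_mk⟩
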